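/- **Setting.** Consider a periodic event-triggered control (PETC) system with checking period $1$, given by real matrices $A\in\mathbb R^{n\times n}$, $B\in\mathbb R^{n\times n_u}$, $K\in\mathbb R^{n_u\times n}$, a symmetric $Q\in\mathbb R^{2n\times 2n}$ and a maximum inter-sample time $\bar k\ge 1$. Put $M(k)=e^{Ak}+\int_0^k e^{A\tau}\,d\tau\,BK$, $N(k)=\begin{bmatrix}M(k)\\ I\end{bmatrix}^{\top}Q\begin{bmatrix}M(k)\\ I\end{bmatrix}$ and $\kappa(x)=\min\{k\in\{1,\dots,\bar k\} : x^\top N(k)x>0\text{ or }k=\bar k\}$. The traffic model $\mathcal S$ has state set $\mathbb R^n$ (all states initial), the transitions $x\to M(\kappa(x))x$ and the output $\kappa(x)$. Its behaviors are the infinite output sequences of its runs. For a transition system with numerical outputs, $V_S$ is the infimum over all runs of $\liminf_{N}\frac1{N+1}\sum_{i=0}^N y_i$, where $y$ is the output sequence of the run; $V_S(\mathcal S)$ is the smallest average inter-sample time (SAIST). For a word $\sigma=k_1\cdots k_m$ let $M_\sigma=M(k_m)\cdots M(k_1)$, and let $\mathcal Q_\sigma$ be the set of states whose first $m$ outputs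 are $k_1,\dots,k_m$; put $\mathcal Q_k=\mathcal Q_\sigma$ for the one-letter word $\sigma=k$. The $l$-complete model $\mathcal S_l$ has as states (all initial) the words $w$ of length $l$ with $\mathcal Q_w\ne\emptyset$, the transitions $k\tau\to\tau k'$ between such words, and as output the first letter. A smallest-in-average cycle (SAC) of $\mathcal S_l$ is a closed walk whose infinite repetition attains $V_S(\mathcal S_l)$; it is identified with its output word. *Isolated SAC.* A word $\beta$ is transient if there is an $L$ such that $\beta$ occurs in no behavior of $\mathcal S$ at a position $>L$. $\mathcal S$ has the isolated SAC $\sigma$, a nonempty word of length $m$, if $\sigma^\omega$ is a behavior of $\mathcal S$, every non-transient length-$m$ block $\beta$ of a behavior has average $\ge V_S(\mathcal S)$, and every such $\beta$ that does not occur in $\sigma^\omega$ has average $>V_S(\mathcal S)$. *Regularity.* A basic invariant subspace of a real matrix is the line spanned by a real eigenvector, or the real plane spanned by the real and imaginary parts of an eigenvector of a non-real eigenvalue. A matrix is mixed if any two of its eigenvalues (counted with multiplicity) of equal modulus are non-real and complex conjugate; it is of irrational rotations if the argument of every non-real eigenvalue is an irrational multiple of $\pi$. The word $\sigma$ is regular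 if $M_\sigma$ is nonsingular, mixed and of irrational rotations, and for every basic invariant subspace $\mathcal A$ of $M_\sigma$ there is an $\epsilon>0$ with $1-\frac{u^\top v}{|u||v|}\ge\epsilon$ for all nonzero $u\in\mathcal A$, $v\in\partial\mathcal Q_\sigma$. *Algorithm.* Start with $l=1$. In each iteration build $\mathcal S_l$, set $\mathtt{SAIST}:=V_S(\mathcal S_l)$, and take some SAC $w=k_1\cdots k_p$ of $\mathcal S_l$. If some basic invariant subspace $\mathcal A$ of $M_w$ satisfies $M(k_{i-1})\cdots M(k_1)\mathcal A\setminus\{0\}\subseteq\mathcal Q_{k_i}$ for $i=1,\dots,p$, return $(l,\mathcal S_l,w,\mathtt{SAIST})$; otherwise increase $l$ by $1$ and repeat. **Theorem.** Suppose that $\mathcal S$ has an isolated SAC $\sigma$ that is regular, and that $\sigma^\omega$ is the behavior of some nonzero initial state. Suppose moreover that $M_w$ is nonsingular for every SAC $w$ of every $\mathcal S_l$, $l\ge1$. Then, whichever SACs are selected, the algorithm never gets stuck (every $\mathcal S_l$ that it builds has a SAC), returns after finitely many iterations, and returns $\mathtt{SAIST}=V_S(\mathcal S)$. -/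

import Mathlib

open scoped Matrix

/-! ## Transition systems, behaviors, limit averages -/

/-- A transition system `(X, X₀, E, Y, H)`. The state set is a subset `states` of a type `X`. -/
structure TransitionSystem (X Y : Type*) where
  states : Set X
  init : Set X
  edge : X → X → Prop
  out : X → Y
  init_subset : init ⊆ states
  edge_left : ∀ x x', edge x x' → x ∈ states
  edge_right : ∀ x x', edge x x' → x' ∈ states

/-- `σ^ω`, the infinite repetition of a (nonempty) finite word `σ`. -/
def omegaPow (σ : List ℕ) : ℕ → ℕ := fun i => σ.getD (i % σ.length) 0

/-- The word `β` occurs as a (contiguous) subsequence of `y`, starting at position `j`. -/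
def OccursAt (β : List ℕ) (y : ℕ → ℕ) (j : ℕ) : Prop :=
  ∀ i (h : i < β.length), y (j + i) = β[i]

/-- `LimAvg(v) = liminf_{n → ∞} (1 / (n + 1)) ∑_{i = 0}^{n} v_i`. -/
noncomputable def limAvg (v : ℕ → ℕ) : ℝ :=
  Filter.liminf (fun n : ℕ => (∑ i ∈ Finset.range (n + 1), (v i : ℝ)) / ((n : ℝ) + 1))
    Filter.atTop

/-- The average of the entries of a finite word. -/
noncomputable def wordAvg (β : List ℕ) : ℝ := (β.sum : ℝ) / (β.length : ℝ)

namespace TransitionSystem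

variable {X : Type*}

/-- Infinite internal behaviors (runs). -/
def IsRun {Y : Type*} (S : TransitionSystem X Y) (r : ℕ → X) : Prop :=
  r 0 ∈ S.init ∧ ∀ i, S.edge (r i) (r (i + 1))

/-- `y` is an infinite external behavior (trace) of `S` starting from the initial state `x`. -/
def IsTraceFrom {Y : Type*} (S : TransitionSystem X Y) (x : X) (y : ℕ → Y) : Prop :=
  ∃ r, S.IsRun r ∧ r 0 = x ∧ ∀ i, S.out (r i) = y i

/-- The set `B^ω(S)` of all infinite external behaviors of `S`. -/
def behaviors {Y : Type*} (S : TransitionSystem X Y) : Set (ℕ → Y) :=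
  {y | ∃ x ∈ S.init, S.IsTraceFrom x y}

/-- `V_S(S)`, the infimum of the limit averages over all runs, where (as for every simple weighted
transition system) the weight of a transition is the output of its source state. -/
noncomputable def smallestValue (S : TransitionSystem X ℕ) : ℝ :=
  sInf {a | ∃ r, S.IsRun r ∧ a = limAvg (fun i => S.out (r i))}

/-- A cycle `x₀ x₁ … x_k` of the digraph of `S`: `x_i → x_{i+1}` for `i < k`, and `x_k → x₀`. -/
def IsCycle {Y : Type*} (S : TransitionSystem X Y) (xs : List X) : Prop :=
  xs ≠ [] ∧ ∀ (i : ℕ) (x x' : X), xs[i]? = some x → xs[(i + 1) % xs.length]? = some x' →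
    S.edge x x'

/-- The output words of the smallest-in-average cycles of `S`, i.e. of the cycles `c` for which
the limit average of `c^ω` equals `V_S(S)`. -/
def sacWords (S : TransitionSystem X ℕ) : Set (List ℕ) :=
  {w | ∃ c, S.IsCycle c ∧ w = c.map S.out ∧ limAvg (omegaPow w) = S.smallestValue}

/-- A finite word is transient if there is a bound on the positions at which it
can occur in the infinite behaviors of `S`. -/
def IsTransient (S : TransitionSystem X ℕ) (β : List ℕ) : Prop :=
  ∃ l : ℕ, ∀ y ∈ S.behaviors, ∀ j, OccursAt β y j → j ≤ l

/-- `S` has the isolated smallest-in-average cycle `σ`. -/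
structure IsIsolatedSAC (S : TransitionSystem X ℕ) (σ : List ℕ) : Prop where
  ne_nil : σ ≠ []
  /-- non-transient fragments of length `|σ|` have average at least `V_S(S)` -/
  le_avg : ∀ y ∈ S.behaviors, ∀ (β : List ℕ) (j : ℕ), β.length = σ.length → OccursAt β y j →
    ¬ S.IsTransient β → S.smallestValue ≤ wordAvg β
  /-- `σ^ω` is a behavior of `S` -/
  mem_behaviors : omegaPow σ ∈ S.behaviors
  /-- non-transient fragments of length `|σ|` that do not occur in `σ^ω` are strictly worse -/
  lt_avg : ∀ y ∈ S.behaviors, ∀ (β : List ℕ) (j : ℕ), β.length = σ.length → OccursAt β y j →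
    ¬ S.IsTransient β → (¬ ∃ i, OccursAt β (omegaPow σ) i) →
    S.smallestValue < limAvg (omegaPow β)

end TransitionSystem

/-! ## Matrices: mixed, irrational rotations, basic invariant subspaces, normalized distance -/

/-- The complex eigenvalues of a real square matrix, with algebraic multiplicities. -/
noncomputable def eigenvaluesC {n : ℕ} (M : Matrix (Fin n) (Fin n) ℝ) : Multiset ℂ :=
  (M.map Complex.ofReal).charpoly.roots

/-- Mixed matrix: two eigenvalues (counted with multiplicity) of the same magnitude are
non-real and complex conjugates of each other. (In an enumeration by decreasing magnitude, any two
eigenvalues of the same magnitude can be made adjacent.) -/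
def IsMixed {n : ℕ} (M : Matrix (Fin n) (Fin n) ℝ) : Prop :=
  (eigenvaluesC M).Pairwise
    (fun a b => ‖a‖ = ‖b‖ → a.im ≠ 0 ∧ a = (starRingEnd ℂ) b)

/-- Matrix of irrational rotations: the argument of every non-real eigenvalue is an irrational
multiple of `π`. -/
def IsIrrationalRotations {n : ℕ} (M : Matrix (Fin n) (Fin n) ℝ) : Prop :=
  ∀ a ∈ eigenvaluesC M, a.im ≠ 0 → Irrational (a.arg / Real.pi)

/-- The basic invariant linear subspaces of `M`: the lines spanned by a real eigenvector, and the
planes spanned (over `ℝ`) by the real and imaginary part of an eigenvector `z` of a non-real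
eigenvalue, that is, the real points of the complex span of `z` and its conjugate. -/
def basicInvariantSubspaces {n : ℕ} (M : Matrix (Fin n) (Fin n) ℝ) :
    Set (Submodule ℝ (Fin n → ℝ)) :=
  {V | (∃ (v : Fin n → ℝ) (a : ℝ), v ≠ 0 ∧ M *ᵥ v = a • v ∧ V = Submodule.span ℝ {v}) ∨
    (∃ (z : Fin n → ℂ) (a : ℂ), a.im ≠ 0 ∧ z ≠ 0 ∧ M.map Complex.ofReal *ᵥ z = a • z ∧
      V = Submodule.span ℝ {fun i => (z i).re, fun i => (z i).im})}

/-- The Euclidean norm on `ℝⁿ`. -/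
noncomputable def euclNorm {n : ℕ} (x : Fin n → ℝ) : ℝ := ‖WithLp.toLp 2 x‖

/-- Normalized distance of a point to a set, an infimum over the nonzero vectors of the set
(`⊤` if there is none). -/
noncomputable def normalizedDist {n : ℕ} (x : Fin n → ℝ) (D : Set (Fin n → ℝ)) : EReal :=
  ⨅ u ∈ D \ {0}, ((1 - (u ⬝ᵥ x) / (euclNorm u * euclNorm x) : ℝ) : EReal)

/-- Normalized distance between two sets, taken over their nonzero vectors. -/
noncomputable def normalizedSetDist {n : ℕ} (C D : Set (Fin n → ℝ)) : EReal :=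
  ⨅ x ∈ C \ {0}, normalizedDist x D

/-! ## PETC systems -/

/-- Data of a linear PETC system: plant `ξ' = A ξ + B υ`, sampled feedback `υ = K ξ(t_i)`,
triggering matrix `Q` and maximum inter-sample time `kbar` (checking period `1`). -/
structure PETC (nx nu : ℕ) where
  A : Matrix (Fin nx) (Fin nx) ℝ
  B : Matrix (Fin nx) (Fin nu) ℝ
  K : Matrix (Fin nu) (Fin nx) ℝ
  Q : Matrix (Fin nx ⊕ Fin nx) (Fin nx ⊕ Fin nx) ℝ
  kbar : ℕ
  Q_symm : Q.IsSymm
  one_le_kbar : 1 ≤ kbar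

namespace PETC

variable {nx nu : ℕ} (P : PETC nx nu)

/-- `M(k) = e^{A k} + (∫₀ᵏ e^{A τ} dτ) B K` (the integral is taken entrywise). -/
noncomputable def M (k : ℕ) : Matrix (Fin nx) (Fin nx) ℝ :=
  NormedSpace.exp ((k : ℝ) • P.A) +
    (Matrix.of fun i j => ∫ τ in (0 : ℝ)..(k : ℝ), (NormedSpace.exp (τ • P.A)) i j) * P.B * P.K

/-- `N(k) = [M(k); I]ᵀ Q [M(k); I]`. -/
noncomputable def N (k : ℕ) : Matrix (Fin nx) (Fin nx) ℝ :=
  Matrix.transpose (Matrix.fromRows (P.M k) (1 : Matrix (Fin nx) (Fin nx) ℝ)) * P.Q *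
    Matrix.fromRows (P.M k) (1 : Matrix (Fin nx) (Fin nx) ℝ)

/-- The inter-sample time
`κ(x) = min {k ∈ {1, …, kbar} | xᵀ N(k) x > 0 or k = kbar}`. -/
noncomputable def kappa (x : Fin nx → ℝ) : ℕ :=
  sInf {k | 1 ≤ k ∧ k ≤ P.kbar ∧ (0 < x ⬝ᵥ P.N k *ᵥ x ∨ k = P.kbar)}

/-- The traffic model `S`: every state is initial, `x → M(κ(x)) x`, with output `κ(x)`. -/
noncomputable def traffic : TransitionSystem (Fin nx → ℝ) ℕ where
  states := Set.univ
  init := Set.univ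
  edge x x' := x' = P.M (P.kappa x) *ᵥ x
  out := P.kappa
  init_subset := fun _ h => h
  edge_left := fun _ _ _ => trivial
  edge_right := fun _ _ _ => trivial

/-- `K_k = {x | xᵀ N(k) x > 0}` for `k < kbar`, and the whole space for `k = kbar`. -/
def setK (k : ℕ) : Set (Fin nx → ℝ) :=
  {x | k < P.kbar → 0 < x ⬝ᵥ P.N k *ᵥ x}

/-- `Q_k = K_k ∩ ⋂_{1 ≤ j < k} (K_j)ᶜ` for `k ∈ {1, …, kbar}` (empty for other `k`). -/
def setQ (k : ℕ) : Set (Fin nx → ℝ) :=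
  {x | 1 ≤ k ∧ k ≤ P.kbar ∧ x ∈ P.setK k ∧ ∀ j, 1 ≤ j → j < k → x ∉ P.setK j}

/-- The `σ`-cone `Q_σ` of `σ = k₁ k₂ … k_m`: the set of `x` with `x ∈ Q_{k₁}`,
`M(k₁) x ∈ Q_{k₂}`, …, `M(k_{m-1}) ⋯ M(k₁) x ∈ Q_{k_m}`. -/
def cone : List ℕ → Set (Fin nx → ℝ)
  | [] => Set.univ
  | k :: w => {x | x ∈ P.setQ k ∧ P.M k *ᵥ x ∈ cone w}

/-- `M_σ = M(k_m) M(k_{m-1}) ⋯ M(k₁)` for `σ = k₁ k₂ … k_m`. -/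
noncomputable def wordM : List ℕ → Matrix (Fin nx) (Fin nx) ℝ
  | [] => 1
  | k :: w => wordM w * P.M k

/-- The inter-sample sequence relation `R_l`. -/
def seqRel (l : ℕ) (x : Fin nx → ℝ) (w : List ℕ) : Prop :=
  w.length = l ∧ x ∈ P.cone w

/-- The `l`-complete traffic model `S_l`: its states are the words of length `l` related to
some `x`, its transitions follow the domino rule, and its output is the first letter. -/
def completeModel (l : ℕ) : TransitionSystem (List ℕ) ℕ where
  states := {w | ∃ x, P.seqRel l x w}
  init := {w | ∃ x, P.seqRel l x w}
  edge w w' := (∃ x, P.seqRel l x w) ∧ (∃ x, P.seqRel l x w') ∧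
    ∃ (k k' : ℕ) (s : List ℕ), w = k :: s ∧ w' = s ++ [k']
  out w := w.headD 0
  init_subset := fun _ h => h
  edge_left := fun _ _ h => h.1
  edge_right := fun _ _ h => h.2.1

/-- Regularity of a word `σ`. -/
structure IsRegular (σ : List ℕ) : Prop where
  nonsingular : (P.wordM σ).det ≠ 0
  mixed : IsMixed (P.wordM σ)
  irrational : IsIrrationalRotations (P.wordM σ)
  clearance : ∀ V ∈ basicInvariantSubspaces (P.wordM σ), ∃ ε : ℝ, 0 < ε ∧
    (ε : EReal) ≤ normalizedSetDist (V : Set (Fin nx → ℝ)) (frontier (P.cone σ))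

/-- The test of a subspace `V` against a word `k₁ k₂ … k_m`: `V \ {0} ⊆ Q_{k₁}`,
`M(k₁) V \ {0} ⊆ Q_{k₂}`, …, `M(k_{m-1}) ⋯ M(k₁) V \ {0} ⊆ Q_{k_m}`. -/
def Verified : Submodule ℝ (Fin nx → ℝ) → List ℕ → Prop
  | _, [] => True
  | V, k :: w => (V : Set (Fin nx → ℝ)) \ {0} ⊆ P.setQ k ∧
      Verified (V.map (P.M k).mulVecLin) w

/-- Configurations of the SAIST algorithm: at the head of the loop with counter `l`, or returned
with output `(l, S_l, σ, SAIST)`. -/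
inductive AlgConfig where
  | loop (l : ℕ)
  | returned (l : ℕ) (Sl : TransitionSystem (List ℕ) ℕ) (w : List ℕ) (saist : ℝ)

/-- One iteration of the main loop of the SAIST algorithm: build `S_l`, compute `V_S(S_l)`, pick
any smallest-in-average cycle of `S_l`, with word `w`; return if some basic invariant subspace of
`M_w` passes the test, and increment `l` otherwise. -/
inductive AlgStep : AlgConfig → AlgConfig → Prop where
  | ret (l : ℕ) (w : List ℕ) (hw : w ∈ (P.completeModel l).sacWords)
      (V : Submodule ℝ (Fin nx → ℝ)) (hV : V ∈ basicInvariantSubspaces (P.wordM w))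
      (hver : P.Verified V w) :
      AlgStep (.loop l)
        (.returned l (P.completeModel l) w (P.completeModel l).smallestValue)
  | next (l : ℕ) (w : List ℕ) (hw : w ∈ (P.completeModel l).sacWords)
      (hver : ∀ V ∈ basicInvariantSubspaces (P.wordM w), ¬ P.Verified V w) :
      AlgStep (.loop l) (.loop (l + 1))

/-- The algorithm, started with `l = 1`, terminates with `SAIST = v`, whatever cycles are
picked: there is no infinite execution, and every configuration reached either has
a successor or is a return with value `v`. -/
def AlgTerminatesWith (v : ℝ) : Prop :=
  (¬ ∃ e : ℕ → AlgConfig, e 0 = .loop 1 ∧ ∀ i, P.AlgStep (e i) (e (i + 1))) ∧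
  ∀ s, Relation.ReflTransGen P.AlgStep (.loop 1) s →
    (∃ s', P.AlgStep s s') ∨ ∃ l Sl w, s = .returned l Sl w v

end PETC

/-! Returned values are correct. Every trace of $\mathcal S$ is a behavior of $\mathcal S_l$, so
$V_S(\mathcal S_l)\le V_S(\mathcal S)$. If a subspace passes the test for a SAC $w$ with $M_w$
nonsingular, its nonzero points return to it every $|w|$ steps and have trace $w^\omega$. So
$V_S(\mathcal S)$ is at most the mean of $w$, which is $V_S(\mathcal S_l)$
(`smallestValue_eq_of_verified`). The loop never gets stuck because a finite digraph with an
infinite walk has a minimum mean cycle (`sacWords_nonempty`).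

Termination has a combinatorial half and a linear half. For large $l$, each block of length
$|\sigma|$ of $w^\omega$ occurs late in some trace, so it is non-transient and has average at least
$V_S(\mathcal S)$. The mean of $w$ is at most $V_S(\mathcal S)$, so all these averages are equal.
Hence $w^\omega$ has period $|\sigma|$, and isolation makes it a shift of $\sigma^\omega$
(`exists_sacWords_eq_rotation`).

For the linear half, the $M_\sigma$-orbit of a nonzero state with trace $\sigma^\omega$ stays in
$\mathcal Q_\sigma$. Its directions accumulate on a basic invariant subspace, the one of the
dominant eigenvalue in the expansion of the state (`exists_tendsto_basicInvariantSubspace`).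
Clearance from $\partial\mathcal Q_\sigma$ puts all nonzero points of that subspace inside $\mathcal
Q_\sigma$. Its image under the prefix matrix $G$ of the shift passes the test for $w$
(`exists_verified_of_rotation`). Since $|w|$ need not be a multiple of $|\sigma|$, $M_w$ is compared
with $M_\sigma$ through commutation and a common power, which is where irrational rotations enter.
-/

/-! ## Words and limit averages -/

/-- The word `y i, y (i + 1), …, y (i + n - 1)`. -/
def seg (y : ℕ → ℕ) (i n : ℕ) : List ℕ := (List.range n).map fun t => y (i + t)

@[simp] lemma length_seg (y : ℕ → ℕ) (i n : ℕ) : (seg y i n).length = n := by simp [seg]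

@[simp] lemma getElem_seg (y : ℕ → ℕ) (i n t : ℕ) (h : t < (seg y i n).length) :
    (seg y i n)[t] = y (i + t) := by simp [seg]

lemma seg_add (y : ℕ → ℕ) (i a b : ℕ) : seg y i (a + b) = seg y i a ++ seg y (i + a) b := by
  simp [seg, List.range_add, Function.comp_def, add_assoc]

lemma seg_congr {y z : ℕ → ℕ} {i j n : ℕ} (h : ∀ t < n, y (i + t) = z (j + t)) :
    seg y i n = seg z j n := by
  apply List.ext_getElem (by simp)
  intro t h₁ _
  simpa using h t (by simpa using h₁)

lemma sum_seg (y : ℕ → ℕ) (i n : ℕ) : (seg y i n).sum = ∑ t ∈ Finset.range n, y (i + t) := by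
  induction n with
  | zero => simp [seg]
  | succ n ih => rw [seg_add, List.sum_append, ih, Finset.sum_range_succ]; simp [seg]

lemma occursAt_seg (y : ℕ → ℕ) (i n : ℕ) : OccursAt (seg y i n) y i := by
  intro t h; simp

lemma omegaPow_periodic (w : List ℕ) : Function.Periodic (omegaPow w) w.length := by
  intro i; simp [omegaPow]

lemma seg_omegaPow (w : List ℕ) : seg (omegaPow w) 0 w.length = w := by
  apply List.ext_getElem (by simp)
  intro t h₁ h₂
  simp [omegaPow, Nat.mod_eq_of_lt h₂, h₂]

lemma omegaPow_seg {y : ℕ → ℕ} {p : ℕ} (hp : 0 < p) (hy : Function.Periodic y p) :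
    omegaPow (seg y 0 p) = y := by
  funext i
  have h := Nat.mod_lt i hp
  simp [omegaPow, seg, List.getD_eq_getElem?_getD, h, hy.map_mod_nat]

lemma sum_range_add_of_periodic {y : ℕ → ℕ} {p : ℕ} (hy : Function.Periodic y p) (t : ℕ) :
    ∑ i ∈ Finset.range p, y (i + t) = ∑ i ∈ Finset.range p, y i := by
  induction t with
  | zero => rfl
  | succ t ih =>
    rw [← ih]
    have h₁ := Finset.sum_range_succ (fun i => y (i + t)) p
    have h₂ := Finset.sum_range_succ' (fun i => y (i + t)) p
    have h₃ : y (p + t) = y (0 + t) := by rw [add_comm, hy, zero_add]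
    have h₄ : ∑ i ∈ Finset.range p, y (i + (t + 1)) = ∑ i ∈ Finset.range p, y (i + 1 + t) :=
      Finset.sum_congr rfl fun i _ => by congr 1; ring
    omega

lemma tendsto_const_div_succ (C : ℝ) :
    Filter.Tendsto (fun n : ℕ => C / ((n : ℝ) + 1)) Filter.atTop (nhds 0) := by
  simpa [div_eq_mul_inv] using (tendsto_one_div_add_atTop_nhds_zero_nat (𝕜 := ℝ)).const_mul C

lemma limAvg_eq_of_abs_sub_le {v : ℕ → ℕ} {a C : ℝ}
    (h : ∀ n : ℕ, |(∑ i ∈ Finset.range n, (v i : ℝ)) - n * a| ≤ C) : limAvg v = a := by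
  apply Filter.Tendsto.liminf_eq
  rw [tendsto_iff_norm_sub_tendsto_zero]
  refine squeeze_zero (fun _ => norm_nonneg _) (fun n => ?_) (tendsto_const_div_succ C)
  have hn : (0 : ℝ) < (n : ℝ) + 1 := by positivity
  rw [Real.norm_eq_abs, div_sub' hn.ne', abs_div, abs_of_pos hn]
  gcongr
  simpa using h (n + 1)

lemma le_limAvg {v : ℕ → ℕ} {a C : ℝ} {K : ℕ} (hK : ∀ i, v i ≤ K)
    (h : ∀ n : ℕ, n * a - C ≤ ∑ i ∈ Finset.range n, (v i : ℝ)) : a ≤ limAvg v := by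
  have ht : Filter.Tendsto (fun n : ℕ => a - C / ((n : ℝ) + 1)) Filter.atTop (nhds a) := by
    simpa using tendsto_const_nhds.sub (tendsto_const_div_succ C)
  rw [← ht.liminf_eq]
  refine Filter.liminf_le_liminf (Filter.Eventually.of_forall fun n => ?_) ?_ ?_
  · have hn : (0 : ℝ) < (n : ℝ) + 1 := by positivity
    have := h (n + 1)
    push_cast at this
    rw [le_div_iff₀ hn, sub_mul, div_mul_cancel₀ _ hn.ne']
    linarith
  · exact ht.isBoundedUnder_ge
  -- The real `liminf` takes a default value on averages tending to infinity; the bound `K` excludes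
  -- this.
  · refine Filter.IsBoundedUnder.isCoboundedUnder_ge ⟨(K : ℝ), ?_⟩
    refine Filter.eventually_map.2 (Filter.Eventually.of_forall fun n => ?_)
    have hn : (0 : ℝ) < (n : ℝ) + 1 := by positivity
    dsimp only
    rw [div_le_iff₀ hn]
    calc (∑ i ∈ Finset.range (n + 1), (v i : ℝ)) ≤ ∑ i ∈ Finset.range (n + 1), (K : ℝ) :=
          Finset.sum_le_sum fun i _ => by exact_mod_cast hK i
      _ = K * (n + 1) := by simp [mul_comm]

lemma limAvg_nonneg {v : ℕ → ℕ} {K : ℕ} (hK : ∀ i, v i ≤ K) : 0 ≤ limAvg v :=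
  le_limAvg (C := 0) hK fun n => by simpa using Finset.sum_nonneg fun i _ => Nat.cast_nonneg _

/-- The deviation `D` of the partial sums from `n` times the mean is periodic, hence bounded, and it
vanishes after division by `n + 1`. -/
lemma limAvg_omegaPow {w : List ℕ} (hw : w ≠ []) : limAvg (omegaPow w) = wordAvg w := by
  have hp : 0 < w.length := List.length_pos_iff.2 hw
  have hp' : (0 : ℝ) < w.length := by exact_mod_cast hp
  have hs : ∑ t ∈ Finset.range w.length, omegaPow w t = w.sum := by
    have := sum_seg (omegaPow w) 0 w.length
    rw [seg_omegaPow] at this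
    simpa using this.symm
  let D : ℕ → ℝ := fun n => (∑ i ∈ Finset.range n, (omegaPow w i : ℝ)) - n * wordAvg w
  have hD : Function.Periodic D w.length := by
    intro n
    have h := sum_range_add_of_periodic (omegaPow_periodic w) n
    rw [hs] at h
    have h' : ∑ i ∈ Finset.range w.length, (omegaPow w (n + i) : ℝ) = w.sum := by
      rw [← h]; push_cast; exact Finset.sum_congr rfl fun i _ => by rw [add_comm]
    simp only [D, Finset.sum_range_add, h', Nat.cast_add, wordAvg]
    field_simp
    ring
  refine limAvg_eq_of_abs_sub_le (C := ∑ i ∈ Finset.range w.length, |D i|) fun n => ?_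
  change |D n| ≤ _
  rw [← hD.map_mod_nat n]
  exact Finset.single_le_sum (f := fun i => |D i|) (fun i _ => abs_nonneg _)
    (Finset.mem_range.2 (Nat.mod_lt _ hp))

/-- A periodic sequence all of whose blocks of length `m` have average at least `a` and whose mean
is at most `a` has all its blocks of average `a`. -/
lemma wordAvg_seg_eq {y : ℕ → ℕ} {p m : ℕ} {a : ℝ} (hp : 0 < p) (hm : 0 < m)
    (hy : Function.Periodic y p) (hle : ∀ i, a ≤ wordAvg (seg y i m))
    (hge : wordAvg (seg y 0 p) ≤ a) (i : ℕ) : wordAvg (seg y i m) = a := by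
  have hp' : (0 : ℝ) < p := by exact_mod_cast hp
  have hm' : (0 : ℝ) < m := by exact_mod_cast hm
  -- Double counting: over one period of starting positions each letter is covered `m` times, so the
  -- block averages have the mean of the sequence as their mean.
  have hsum : ∑ i ∈ Finset.range p, wordAvg (seg y i m) = p * wordAvg (seg y 0 p) := by
    have h : ∑ i ∈ Finset.range p, (seg y i m).sum = m * (seg y 0 p).sum := by
      simp only [sum_seg, zero_add]
      rw [Finset.sum_comm]
      simp [sum_range_add_of_periodic hy]
    have h' : (∑ i ∈ Finset.range p, ((seg y i m).sum : ℝ)) = m * (seg y 0 p).sum := by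
      exact_mod_cast h
    simp only [wordAvg, length_seg, ← Finset.sum_div, h']
    field_simp
  have heq : ∀ i ∈ Finset.range p, a = wordAvg (seg y i m) := by
    refine (Finset.sum_eq_sum_iff_of_le fun i _ => hle i).1 (le_antisymm ?_ ?_)
    · exact Finset.sum_le_sum fun i _ => hle i
    · rw [hsum]; simpa using mul_le_mul_of_nonneg_left hge hp'.le
  rw [heq (i % p) (Finset.mem_range.2 (Nat.mod_lt _ hp))]
  congr 1
  refine seg_congr fun t _ => ?_
  conv_lhs => rw [← Nat.mod_add_div i p]
  rw [add_right_comm, mul_comm, ← smul_eq_mul]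
  exact hy.nsmul _ _

/-- The blocks at `i` and `i + 1` differ only by losing `y i` and gaining `y (i + m)`; equal sums
force these to agree. -/
lemma periodic_of_wordAvg_seg_eq {y : ℕ → ℕ} {m : ℕ} {a : ℝ} (hm : 0 < m)
    (h : ∀ i, wordAvg (seg y i m) = a) : Function.Periodic y m := by
  intro i
  have hm' : (m : ℝ) ≠ 0 := by exact_mod_cast hm.ne'
  have h₁ := (h i).trans (h (i + 1)).symm
  simp only [wordAvg, length_seg] at h₁
  have h₂ : (seg y i m).sum = (seg y (i + 1) m).sum := by
    exact_mod_cast (div_left_inj' hm').1 h₁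
  have h₃ := congrArg List.sum (seg_add y i m 1)
  have h₄ := congrArg List.sum (seg_add y i 1 m)
  rw [add_comm 1 m, h₃, List.sum_append, List.sum_append, h₂] at h₄
  simp [seg] at h₄
  omega

/-! ## Minimum mean cycles in finite digraphs -/

lemma finite_setOf_length_eq_of_le (n K : ℕ) :
    {w : List ℕ | w.length = n ∧ ∀ k ∈ w, k ≤ K}.Finite := by
  refine ((List.finite_length_eq (Fin (K + 1)) n).image (List.map Fin.val)).subset ?_
  rintro w ⟨hw, hK⟩
  refine ⟨w.map (Fin.ofNat (K + 1)), by simpa using hw, ?_⟩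
  rw [List.map_map]
  conv_rhs => rw [← List.map_id w]
  refine List.map_congr_left fun k hk => ?_
  simpa using Nat.mod_eq_of_lt (Nat.lt_succ_of_le (hK k hk))

section MinimumMean

variable {X : Type*} {s : Set X} {E : X → X → Prop}

lemma exists_lt_le_card_eq (hs : s.Finite) {r : ℕ → X} (hr : ∀ i, r i ∈ s) :
    ∃ i j, i < j ∧ j ≤ s.ncard ∧ r i = r j := by
  classical
  have hcard : hs.toFinset.card < (Finset.range (s.ncard + 1)).card := by
    rw [Finset.card_range, ← Set.ncard_eq_toFinset_card s hs]; omega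
  obtain ⟨i, hi, j, hj, hne, he⟩ := Finset.exists_ne_map_eq_of_card_lt_of_maps_to hcard
    (f := r) (fun i _ => by simpa using hr i)
  simp only [Finset.mem_range] at hi hj
  rcases lt_or_gt_of_ne hne with h | h
  · exact ⟨i, j, h, by omega, he⟩
  · exact ⟨j, i, h, by omega, he.symm⟩

/-- A repeated state splits a walk into a closed walk, repeated forever here, and the walk that
remains after its excision, treated in `edge_cut`. -/
lemma edge_cycle {r : ℕ → X} (hr : ∀ i, E (r i) (r (i + 1))) {i q : ℕ} (hq : 0 < q)
    (h : r i = r (i + q)) (t : ℕ) : E (r (i + t % q)) (r (i + (t + 1) % q)) := by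
  have hlt := Nat.mod_lt t hq
  rcases Nat.lt_or_ge (t % q + 1) q with h1 | h1
  · have : (t + 1) % q = t % q + 1 := by
      rw [Nat.add_mod, Nat.mod_eq_of_lt (show 1 < q by omega), Nat.mod_eq_of_lt h1]
    rw [this]; exact hr _
  · have h2 : t % q + 1 = q := by omega
    have : (t + 1) % q = 0 := by
      rw [← Nat.mod_add_mod, h2, Nat.mod_self]
    rw [this, add_zero, h]
    have := hr (i + t % q)
    rwa [add_assoc, h2] at this

lemma edge_cut {r : ℕ → X} (hr : ∀ i, E (r i) (r (i + 1))) {i q : ℕ} (h : r i = r (i + q))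
    (t : ℕ) : E (if t < i then r t else r (t + q)) (if t + 1 < i then r (t + 1)
      else r (t + 1 + q)) := by
  rcases lt_trichotomy (t + 1) i with h1 | h1 | h1
  · rw [if_pos (by omega), if_pos h1]; exact hr _
  · rw [if_pos (by omega), if_neg (by omega), h1, ← h, ← h1]; exact hr _
  · rw [if_neg (by omega), if_neg (by omega), add_right_comm]; exact hr _

/-- Induction by excising a short cycle, which costs at least `a` per step. Fewer than `s.ncard`
steps remain at the end, and the term `s.ncard * a` absorbs them. -/
lemma le_sum_of_le_cycle_avg (hs : s.Finite) (hE : ∀ a b, E a b → a ∈ s) (f : X → ℕ) {a : ℝ}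
    (ha : 0 ≤ a)
    (hmin : ∀ (r : ℕ → X) (p : ℕ), 0 < p → p ≤ s.ncard → Function.Periodic r p →
      (∀ i, E (r i) (r (i + 1))) → a ≤ wordAvg (seg (fun i => f (r i)) 0 p)) (n : ℕ) :
    ∀ r : ℕ → X, (∀ i, E (r i) (r (i + 1))) →
      n * a - s.ncard * a ≤ ∑ i ∈ Finset.range n, (f (r i) : ℝ) := by
  induction n using Nat.strong_induction_on with
  | _ n ih =>
    intro r hr
    rcases Nat.lt_or_ge n s.ncard with hn | hn
    · refine le_trans ?_ (Finset.sum_nonneg fun i _ => Nat.cast_nonneg _)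
      rw [← sub_mul]
      refine mul_nonpos_of_nonpos_of_nonneg ?_ ha
      have : (n : ℝ) ≤ s.ncard := by exact_mod_cast hn.le
      linarith
    obtain ⟨i, j, hij, hj, he⟩ := exists_lt_le_card_eq hs fun i => hE _ _ (hr i)
    obtain ⟨q, rfl⟩ := Nat.exists_eq_add_of_lt hij
    set q' := q + 1 with hq'
    rw [show i + q + 1 = i + q' by omega] at he hj
    obtain ⟨m, rfl⟩ : ∃ m, n = i + (q' + m) := ⟨n - (i + q'), by omega⟩
    have hq0 : (0 : ℝ) < q' := by rw [hq']; positivity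
    have h₁ := hmin (fun t => r (i + t % q')) q' (by omega) (by omega)
      (fun t => by simp) (edge_cycle hr (by omega) he)
    rw [wordAvg, length_seg, sum_seg, le_div_iff₀ hq0] at h₁
    have h₁' : a * q' ≤ ∑ t ∈ Finset.range q', (f (r (i + t)) : ℝ) := by
      refine h₁.trans_eq ?_
      push_cast
      refine Finset.sum_congr rfl fun t ht => ?_
      rw [zero_add, Nat.mod_eq_of_lt (Finset.mem_range.1 ht)]
    have h₂ := ih (i + m) (by omega) _ (edge_cut hr he)
    rw [Finset.sum_range_add] at h₂ ⊢
    rw [Finset.sum_range_add]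
    have h₃ : ∑ x ∈ Finset.range i, (f (if x < i then r x else r (x + q')) : ℝ) =
        ∑ x ∈ Finset.range i, (f (r x) : ℝ) :=
      Finset.sum_congr rfl fun t ht => by rw [if_pos (Finset.mem_range.1 ht)]
    have h₄ : ∑ x ∈ Finset.range m, (f (if i + x < i then r (i + x) else r (i + x + q')) : ℝ) =
        ∑ x ∈ Finset.range m, (f (r (i + (q' + x))) : ℝ) :=
      Finset.sum_congr rfl fun t _ => by
        rw [if_neg (by omega), show i + t + q' = i + (q' + t) by ring]
    rw [h₃, h₄] at h₂
    push_cast at h₂ ⊢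
    linarith

/-- In a finite digraph with an infinite walk, some closed walk minimizes the limit average. -/
lemma exists_periodic_run_limAvg_le (hs : s.Finite) (hE : ∀ a b, E a b → a ∈ s) (f : X → ℕ)
    {r₀ : ℕ → X} (hr₀ : ∀ i, E (r₀ i) (r₀ (i + 1))) :
    ∃ (r : ℕ → X) (p : ℕ), 0 < p ∧ Function.Periodic r p ∧ (∀ i, E (r i) (r (i + 1))) ∧
      ∀ r' : ℕ → X, (∀ i, E (r' i) (r' (i + 1))) →
        limAvg (fun i => f (r i)) ≤ limAvg (fun i => f (r' i)) := by
  obtain ⟨K, hK⟩ : ∃ K, ∀ x ∈ s, f x ≤ K := by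
    obtain ⟨K, hK⟩ := (hs.image f).bddAbove
    exact ⟨K, fun x hx => hK ⟨x, hx, rfl⟩⟩
  -- Cycles no longer than the number of states have only finitely many averages, so a least one
  -- exists; excision shows that it bounds every walk.
  let A : Set ℝ := {a | ∃ (r : ℕ → X) (p : ℕ), 0 < p ∧ p ≤ s.ncard ∧ Function.Periodic r p ∧
    (∀ i, E (r i) (r (i + 1))) ∧ a = wordAvg (seg (fun i => f (r i)) 0 p)}
  have hfin : A.Finite := by
    refine (((Set.finite_Iic (s.ncard * K)).prod (Set.finite_Iic s.ncard)).image
      (fun q : ℕ × ℕ => (q.1 : ℝ) / q.2)).subset ?_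
    rintro a ⟨r, p, -, hp, -, hr, rfl⟩
    refine ⟨((seg (fun i => f (r i)) 0 p).sum, p), ⟨?_, hp⟩, by simp [wordAvg]⟩
    simp only [sum_seg, Set.mem_Iic]
    calc ∑ t ∈ Finset.range p, f (r (0 + t)) ≤ ∑ t ∈ Finset.range p, K :=
          Finset.sum_le_sum fun t _ => hK _ (hE _ _ (hr _))
      _ = p * K := by simp
      _ ≤ _ := by gcongr
  have hne : A.Nonempty := by
    obtain ⟨i, j, hij, hj, he⟩ := exists_lt_le_card_eq hs fun i => hE _ _ (hr₀ i)
    obtain ⟨q, rfl⟩ := Nat.exists_eq_add_of_lt hij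
    exact ⟨_, fun t => r₀ (i + t % (q + 1)), q + 1, by omega, by omega, fun t => by simp,
      edge_cycle hr₀ (by omega) he, rfl⟩
  obtain ⟨a, ⟨r, p, hp, hps, hper, hr, rfl⟩, hmin⟩ := Set.exists_min_image A id hfin hne
  refine ⟨r, p, hp, hper, hr, fun r' hr' => ?_⟩
  have hper' : Function.Periodic (fun i => f (r i)) p := fun i => by simp [hper i]
  have hnil : seg (fun i => f (r i)) 0 p ≠ [] := by
    rw [← List.length_pos_iff]; simpa using hp
  rw [← omegaPow_seg hp hper', limAvg_omegaPow hnil]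
  refine le_limAvg (fun i => hK _ (hE _ _ (hr' i))) (fun n => ?_) (C := s.ncard *
    wordAvg (seg (fun i => f (r i)) 0 p))
  refine le_sum_of_le_cycle_avg hs hE f (div_nonneg (Nat.cast_nonneg _) (Nat.cast_nonneg _))
    (fun r'' p' h₁ h₂ h₃ h₄ => hmin _ ⟨r'', p', h₁, h₂, h₃, h₄, rfl⟩) n r' hr'

end MinimumMean

namespace PETC

variable {nx nu : ℕ} (P : PETC nx nu)

/-! ## The traffic model -/

lemma mem_setQ_iff {x : Fin nx → ℝ} {k : ℕ} : x ∈ P.setQ k ↔ P.kappa x = k := by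
  have hne : {k | 1 ≤ k ∧ k ≤ P.kbar ∧ (0 < x ⬝ᵥ P.N k *ᵥ x ∨ k = P.kbar)}.Nonempty :=
    ⟨P.kbar, P.one_le_kbar, le_rfl, Or.inr rfl⟩
  have hK : ∀ j, j ≤ P.kbar → (x ∈ P.setK j ↔ (0 < x ⬝ᵥ P.N j *ᵥ x ∨ j = P.kbar)) := by
    intro j hj
    simp only [setK, Set.mem_ofPred_eq]
    rcases hj.lt_or_eq with h | h
    · simp [h, h.ne]
    · simp [h]
  constructor
  · rintro ⟨h1, h2, h3, h4⟩
    have hmem : k ∈ {k | 1 ≤ k ∧ k ≤ P.kbar ∧ (0 < x ⬝ᵥ P.N k *ᵥ x ∨ k = P.kbar)} :=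
      ⟨h1, h2, (hK k h2).1 h3⟩
    refine le_antisymm (Nat.sInf_le hmem) ?_
    by_contra! hlt
    have hm := Nat.sInf_mem hne
    exact h4 _ hm.1 hlt ((hK _ hm.2.1).2 hm.2.2)
  · rintro rfl
    have hm := Nat.sInf_mem hne
    refine ⟨hm.1, hm.2.1, (hK _ hm.2.1).2 hm.2.2, fun j hj hlt hmem => ?_⟩
    have hj' : j ≤ P.kbar := hlt.le.trans hm.2.1
    exact Nat.notMem_of_lt_sInf hlt ⟨hj, hj', (hK _ hj').1 hmem⟩

lemma kappa_le (x : Fin nx → ℝ) : P.kappa x ≤ P.kbar := (P.mem_setQ_iff.2 rfl).2.1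

/-- The successor map of the traffic model. -/
noncomputable def succ (x : Fin nx → ℝ) : Fin nx → ℝ := P.M (P.kappa x) *ᵥ x

/-- The output sequence of the run from `x`. -/
noncomputable def trace (x : Fin nx → ℝ) (i : ℕ) : ℕ := P.kappa (P.succ^[i] x)

lemma trace_iterate (x : Fin nx → ℝ) (j i : ℕ) : P.trace (P.succ^[j] x) i = P.trace x (j + i) := by
  rw [trace, trace, ← Function.iterate_add_apply, add_comm]

lemma mem_cone_iff {x : Fin nx → ℝ} {w : List ℕ} :
    x ∈ P.cone w ↔ seg (P.trace x) 0 w.length = w := by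
  induction w generalizing x with
  | nil => simp [cone, seg]
  | cons k w ih =>
    have h : seg (P.trace x) 0 (k :: w).length =
        P.kappa x :: seg (P.trace (P.succ x)) 0 w.length := by
      rw [List.length_cons, add_comm, seg_add]
      simp only [seg, List.range_one, List.map_cons, List.map_nil, List.cons_append,
        List.nil_append]
      congr 1
      exact List.map_congr_left fun t _ => by simpa using (P.trace_iterate x 1 t).symm
    rw [h, List.cons.injEq, ← ih, ← P.mem_setQ_iff]
    simp only [cone, Set.mem_ofPred_eq]
    refine and_congr_right fun hk => ?_
    rw [succ, P.mem_setQ_iff.1 hk]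

lemma mem_cone_seg {x : Fin nx → ℝ} {y : ℕ → ℕ} {j n : ℕ} :
    x ∈ P.cone (seg y j n) ↔ ∀ t < n, P.trace x t = y (j + t) := by
  rw [mem_cone_iff, length_seg]
  refine ⟨fun h t ht => ?_, fun h => seg_congr fun t ht => by simpa using h t ht⟩
  have := List.getElem_of_eq h (i := t) (by simpa using ht)
  simpa using this

lemma wordM_append (u v : List ℕ) : P.wordM (u ++ v) = P.wordM v * P.wordM u := by
  induction u with
  | nil => simp [wordM]
  | cons k u ih => simp [wordM, ih, mul_assoc]

lemma iterate_succ_eq (x : Fin nx → ℝ) (i : ℕ) :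
    P.succ^[i] x = P.wordM (seg (P.trace x) 0 i) *ᵥ x := by
  induction i with
  | zero => simp [seg, wordM]
  | succ i ih =>
    rw [Function.iterate_succ_apply', seg_add, wordM_append, ← Matrix.mulVec_mulVec, ← ih]
    simp [seg, wordM, succ, trace]

lemma isRun_traffic_iff {r : ℕ → Fin nx → ℝ} :
    P.traffic.IsRun r ↔ ∀ i, r i = P.succ^[i] (r 0) := by
  constructor
  · rintro ⟨-, h⟩ i
    induction i with
    | zero => rfl
    | succ i ih => rw [Function.iterate_succ_apply', ← ih]; exact h i
  · intro h
    refine ⟨trivial, fun i => ?_⟩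
    change r (i + 1) = P.succ (r i)
    rw [h (i + 1), h i, Function.iterate_succ_apply']

lemma isTraceFrom_iff {x : Fin nx → ℝ} {y : ℕ → ℕ} :
    P.traffic.IsTraceFrom x y ↔ P.trace x = y := by
  constructor
  · rintro ⟨r, hr, rfl, hy⟩
    funext i
    rw [← hy i, P.isRun_traffic_iff.1 hr i]; rfl
  · rintro rfl
    exact ⟨fun i => P.succ^[i] x, P.isRun_traffic_iff.2 fun i => rfl, rfl, fun i => rfl⟩

lemma mem_behaviors_iff {y : ℕ → ℕ} : y ∈ P.traffic.behaviors ↔ ∃ x, P.trace x = y := by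
  simp only [TransitionSystem.behaviors, isTraceFrom_iff]
  exact ⟨fun ⟨x, _, h⟩ => ⟨x, h⟩, fun ⟨x, h⟩ => ⟨x, trivial, h⟩⟩

lemma smallestValue_traffic_le (x : Fin nx → ℝ) :
    P.traffic.smallestValue ≤ limAvg (P.trace x) := by
  refine csInf_le ⟨0, ?_⟩ ⟨fun i => P.succ^[i] x, P.isRun_traffic_iff.2 fun i => rfl, rfl⟩
  rintro a ⟨r, -, rfl⟩
  exact limAvg_nonneg fun i => P.kappa_le (r i)

lemma le_smallestValue_traffic {a : ℝ} (h : ∀ x, a ≤ limAvg (P.trace x)) :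
    a ≤ P.traffic.smallestValue := by
  refine le_csInf ⟨_, fun i => P.succ^[i] 0, P.isRun_traffic_iff.2 fun i => rfl, rfl⟩ ?_
  rintro b ⟨r, hr, rfl⟩
  refine (h (r 0)).trans_eq (congrArg limAvg (funext fun i => ?_))
  rw [P.isRun_traffic_iff.1 hr i]; rfl

/-! ## The `l`-complete models -/

lemma mem_states_iff {l : ℕ} {w : List ℕ} :
    w ∈ (P.completeModel l).states ↔ w.length = l ∧ (P.cone w).Nonempty := by
  simp [completeModel, seqRel, Set.Nonempty]

lemma le_kbar_of_mem_cone {x : Fin nx → ℝ} {w : List ℕ} (hx : x ∈ P.cone w) :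
    ∀ k ∈ w, k ≤ P.kbar := by
  rw [P.mem_cone_iff] at hx
  rw [← hx]
  simp only [seg, List.mem_map]
  rintro k ⟨t, -, rfl⟩
  exact P.kappa_le _

lemma finite_states (l : ℕ) : (P.completeModel l).states.Finite := by
  refine (finite_setOf_length_eq_of_le l P.kbar).subset fun w hw => ?_
  obtain ⟨h, x, hx⟩ := P.mem_states_iff.1 hw
  exact ⟨h, P.le_kbar_of_mem_cone hx⟩

/-- With the converse `eq_seg_of_edge`, this identifies the runs of $\mathcal S_l$ with the sliding
windows over sequences all of whose length-`l` windows have nonempty cones. -/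
lemma edge_seg {l : ℕ} (hl : 1 ≤ l) {y : ℕ → ℕ} (hy : ∀ i, (P.cone (seg y i l)).Nonempty) (i : ℕ) :
    (P.completeModel l).edge (seg y i l) (seg y (i + 1) l) := by
  refine ⟨P.mem_states_iff.2 ⟨by simp, hy _⟩, P.mem_states_iff.2 ⟨by simp, hy _⟩,
    y i, y (i + l), seg y (i + 1) (l - 1), ?_, ?_⟩
  · obtain ⟨l, rfl⟩ := Nat.exists_eq_add_of_le hl
    rw [seg_add]; simp [seg]
  · obtain ⟨l, rfl⟩ := Nat.exists_eq_add_of_le' hl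
    rw [seg_add]; simp [seg, add_assoc, add_comm 1 l]

lemma out_seg {l : ℕ} (hl : 1 ≤ l) (y : ℕ → ℕ) (i : ℕ) :
    (P.completeModel l).out (seg y i l) = y i := by
  obtain ⟨l, rfl⟩ := Nat.exists_eq_add_of_le hl
  rw [seg_add]; simp [seg, completeModel]

/-- By the domino rule, letter `t` of a state is the first letter of the state reached `t` steps
later. -/
lemma eq_seg_of_edge {l : ℕ} {r : ℕ → List ℕ}
    (hr : ∀ i, (P.completeModel l).edge (r i) (r (i + 1))) (i : ℕ) :
    r i = seg (fun i => (P.completeModel l).out (r i)) i l := by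
  have hlen : ∀ i, (r i).length = l := fun i => (P.mem_states_iff.1 (hr i).1).1
  have key : ∀ t i, t < l → (r i)[t]? = some ((P.completeModel l).out (r (i + t))) := by
    intro t
    induction t with
    | zero =>
      intro i _
      obtain ⟨-, -, k, k', s, h, -⟩ := hr i
      simp [h, completeModel]
    | succ t ih =>
      intro i ht
      have h₃ := hlen i
      obtain ⟨-, -, k, k', s, h₁, h₂⟩ := hr i
      have h₄ := ih (i + 1) (by omega)
      rw [h₁, List.length_cons] at h₃
      rw [h₂, List.getElem?_append_left (by omega)] at h₄
      rw [h₁, List.getElem?_cons_succ, h₄, add_assoc, add_comm 1 t]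
  apply List.ext_getElem (by simp [hlen i])
  intro t h₁ h₂
  rw [hlen i] at h₁
  have := key t i h₁
  rw [List.getElem?_eq_some_iff] at this
  simpa using this.2

lemma cone_seg_nonempty_of_edge {l : ℕ} {r : ℕ → List ℕ}
    (hr : ∀ i, (P.completeModel l).edge (r i) (r (i + 1))) (i : ℕ) :
    (P.cone (seg (fun i => (P.completeModel l).out (r i)) i l)).Nonempty := by
  rw [← P.eq_seg_of_edge hr i]; exact (P.mem_states_iff.1 (hr i).1).2

lemma cone_seg_trace_nonempty (x : Fin nx → ℝ) (i l : ℕ) :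
    (P.cone (seg (P.trace x) i l)).Nonempty :=
  ⟨P.succ^[i] x, P.mem_cone_seg.2 fun t _ => P.trace_iterate x i t⟩

lemma isRun_completeModel_iff {l : ℕ} {r : ℕ → List ℕ} :
    (P.completeModel l).IsRun r ↔ ∀ i, (P.completeModel l).edge (r i) (r (i + 1)) :=
  ⟨fun h => h.2, fun h => ⟨(h 0).1, h⟩⟩

lemma smallestValue_completeModel_le {l : ℕ} (hl : 1 ≤ l) {y : ℕ → ℕ}
    (hy : ∀ i, (P.cone (seg y i l)).Nonempty) :
    (P.completeModel l).smallestValue ≤ limAvg y := by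
  refine csInf_le ⟨0, ?_⟩ ⟨fun i => seg y i l, P.isRun_completeModel_iff.2 (P.edge_seg hl hy), ?_⟩
  · rintro a ⟨r, hr, rfl⟩
    rw [isRun_completeModel_iff] at hr
    refine limAvg_nonneg (K := P.kbar) fun i => ?_
    obtain ⟨x, hx⟩ := P.cone_seg_nonempty_of_edge hr i
    obtain ⟨l, rfl⟩ := Nat.exists_eq_add_of_le' hl
    rw [P.mem_cone_seg] at hx
    exact (hx 0 (by omega)).symm.trans_le (P.kappa_le _)
  · simp [P.out_seg hl]

lemma smallestValue_completeModel_le_traffic {l : ℕ} (hl : 1 ≤ l) :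
    (P.completeModel l).smallestValue ≤ P.traffic.smallestValue :=
  P.le_smallestValue_traffic fun x =>
    P.smallestValue_completeModel_le hl fun i => P.cone_seg_trace_nonempty x i l

/-- The states of a cycle are the windows of its repeated output word, so SACs can be handled as
periodic sequences. The word may be shorter than `l`. -/
lemma mem_sacWords_iff {l : ℕ} (hl : 1 ≤ l) {w : List ℕ} :
    w ∈ (P.completeModel l).sacWords ↔ w ≠ [] ∧
      (∀ i, (P.cone (seg (omegaPow w) i l)).Nonempty) ∧
      limAvg (omegaPow w) = (P.completeModel l).smallestValue := by
  constructor
  · rintro ⟨c, ⟨hne, hc⟩, rfl, h⟩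
    have hpos : 0 < c.length := List.length_pos_iff.2 hne
    refine ⟨by simpa using hne, ?_, h⟩
    have hlt : ∀ i, i % c.length < c.length := fun i => Nat.mod_lt i hpos
    have hedge : ∀ i, (P.completeModel l).edge (c.get ⟨_, hlt i⟩) (c.get ⟨_, hlt (i + 1)⟩) := by
      intro i
      refine hc (i % c.length) _ _ (by simp [hlt i]) ?_
      rw [Nat.mod_add_mod]; simp [hlt (i + 1)]
    have := P.cone_seg_nonempty_of_edge (r := fun i => c.get ⟨_, hlt i⟩) hedge
    convert! this using 4
    funext i
    simp [omegaPow, hlt i]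
  · rintro ⟨hne, hy, h⟩
    have hpos : 0 < w.length := List.length_pos_iff.2 hne
    refine ⟨(List.range w.length).map fun i => seg (omegaPow w) i l, ⟨?_, ?_⟩, ?_, h⟩
    · rw [← List.length_pos_iff]; simpa using hpos
    · intro i x x' hx hx'
      rw [List.length_map, List.length_range] at hx'
      rw [List.getElem?_map] at hx hx'
      have hi : i < w.length := by
        by_contra! hi
        simp [hi] at hx
      rw [List.getElem?_range hi, Option.map_some, Option.some_inj] at hx
      rw [List.getElem?_range (Nat.mod_lt _ hpos), Option.map_some, Option.some_inj] at hx'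
      subst hx hx'
      have : seg (omegaPow w) ((i + 1) % w.length) l = seg (omegaPow w) (i + 1) l := by
        refine seg_congr fun t _ => ?_
        rw [← (omegaPow_periodic w).map_mod_nat, Nat.mod_add_mod,
          (omegaPow_periodic w).map_mod_nat]
      rw [this]
      exact P.edge_seg hl hy i
    · rw [List.map_map]
      conv_lhs => rw [← seg_omegaPow w]
      refine List.map_congr_left fun t _ => ?_
      simp [P.out_seg hl]

lemma sacWords_nonempty {l : ℕ} (hl : 1 ≤ l) : (P.completeModel l).sacWords.Nonempty := by
  obtain ⟨r, p, hp, hper, hr, hmin⟩ := exists_periodic_run_limAvg_le (P.finite_states l)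
    (P.completeModel l).edge_left (P.completeModel l).out
    (P.edge_seg hl fun i => P.cone_seg_trace_nonempty 0 i l)
  set y : ℕ → ℕ := fun i => (P.completeModel l).out (r i) with hy
  have hyper : Function.Periodic y p := fun i => by simp [hy, hper i]
  have hadm : ∀ i, (P.cone (seg y i l)).Nonempty := P.cone_seg_nonempty_of_edge hr
  refine ⟨seg y 0 p, (P.mem_sacWords_iff hl).2 ?_⟩
  rw [omegaPow_seg hp hyper]
  refine ⟨?_, hadm, le_antisymm ?_ (P.smallestValue_completeModel_le hl hadm)⟩
  · rw [← List.length_pos_iff]; simpa using hp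
  · refine le_csInf ⟨_, r, P.isRun_completeModel_iff.2 hr, rfl⟩ ?_
    rintro a ⟨r', hr', rfl⟩
    exact hmin r' (P.isRun_completeModel_iff.1 hr')

/-! ## Smallest-in-average cycles of the `l`-complete models for large `l` -/

/-- Only finitely many words of length `m` have letters at most `kbar`, so their individual bounds
have a common upper bound. -/
lemma exists_transient_bound (m : ℕ) :
    ∃ L : ℕ, ∀ x j, L < j → ¬ P.traffic.IsTransient (seg (P.trace x) j m) := by
  have hfin := (finite_setOf_length_eq_of_le m P.kbar).subset
    (t := {β : List ℕ | (β.length = m ∧ ∀ k ∈ β, k ≤ P.kbar) ∧ P.traffic.IsTransient β}) fun _ h => h.1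
  choose! b hb using fun β : List ℕ => fun h : P.traffic.IsTransient β => h
  obtain ⟨L, hL⟩ := (hfin.image b).bddAbove
  refine ⟨L, fun x j hj htr => ?_⟩
  have h₁ := hb _ htr (P.trace x) (P.mem_behaviors_iff.2 ⟨x, rfl⟩) j (occursAt_seg _ _ _)
  have h₂ : b (seg (P.trace x) j m) ≤ L := by
    refine hL ⟨_, ⟨⟨by simp, ?_⟩, htr⟩, rfl⟩
    simp only [seg, List.mem_map]
    rintro k ⟨t, -, rfl⟩
    exact P.kappa_le _
  omega

/-- For large `l`, the smallest-in-average cycles of the `l`-complete model are the rotations of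
the isolated smallest-in-average cycle, up to repetition. -/
lemma exists_sacWords_eq_rotation {σ : List ℕ} (hiso : P.traffic.IsIsolatedSAC σ) :
    ∃ l₀, ∀ l, l₀ ≤ l → 1 ≤ l → ∀ w ∈ (P.completeModel l).sacWords,
      ∃ j, ∀ i, omegaPow w i = omegaPow σ (j + i) := by
  have hm : 0 < σ.length := List.length_pos_iff.2 hiso.ne_nil
  set m := σ.length with hmdef
  obtain ⟨L, hL⟩ := P.exists_transient_bound m
  -- A window of this length holds a block of length `m` preceded by `L + 1` letters.
  refine ⟨L + 1 + m, fun l hl hl1 w hw => ?_⟩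
  obtain ⟨hne, hadm, hval⟩ := (P.mem_sacWords_iff hl1).1 hw
  have hp : 0 < w.length := List.length_pos_iff.2 hne
  set y := omegaPow w with hy
  have hper : Function.Periodic y w.length := omegaPow_periodic w
  -- By periodicity the block recurs at a position at least `L + 1`. The window starting `L + 1`
  -- letters earlier begins the trace of some `x`, so the block occurs there past the transient
  -- bound.
  have hblock : ∀ i, ∃ x, seg y i m = seg (P.trace x) (L + 1) m := by
    intro i
    obtain ⟨q, hq⟩ : ∃ q, L + 1 ≤ i + q * w.length :=
      ⟨L + 1, le_add_left (Nat.le_mul_of_pos_right _ hp)⟩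
    obtain ⟨x, hx⟩ := hadm (i + q * w.length - (L + 1))
    rw [P.mem_cone_seg] at hx
    refine ⟨x, seg_congr fun t ht => ?_⟩
    rw [hx _ (by omega), show i + q * w.length - (L + 1) + (L + 1 + t) = i + t + q * w.length by
      omega, ← smul_eq_mul]
    exact (hper.nsmul q _).symm
  have hle : ∀ i, P.traffic.smallestValue ≤ wordAvg (seg y i m) := by
    intro i
    obtain ⟨x, hx⟩ := hblock i
    rw [hx]
    exact hiso.le_avg (P.trace x) (P.mem_behaviors_iff.2 ⟨x, rfl⟩) _ (L + 1) (by simp [hmdef])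
      (occursAt_seg _ _ _) (hL x _ (Nat.lt_succ_self L))
  have hge : wordAvg (seg y 0 w.length) ≤ P.traffic.smallestValue := by
    rw [hy, seg_omegaPow, ← limAvg_omegaPow hne, hval]
    exact P.smallestValue_completeModel_le_traffic hl1
  have heq := wordAvg_seg_eq hp hm hper hle hge
  have hperm : Function.Periodic y m := periodic_of_wordAvg_seg_eq hm heq
  obtain ⟨x, hx⟩ := hblock 0
  obtain ⟨j, hj⟩ : ∃ j, OccursAt (seg (P.trace x) (L + 1) m) (omegaPow σ) j := by
    by_contra hno
    have h := hiso.lt_avg (P.trace x) (P.mem_behaviors_iff.2 ⟨x, rfl⟩) _ (L + 1)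
      (by simp [hmdef]) (occursAt_seg _ _ _) (hL x _ (Nat.lt_succ_self L)) hno
    rw [← hx, limAvg_omegaPow (by rw [← List.length_pos_iff]; simpa using hm), heq 0] at h
    exact lt_irrefl _ h
  refine ⟨j, fun i => ?_⟩
  rw [← hx] at hj
  -- Both sequences have period `m`, so agreement on one block is agreement everywhere.
  have h := hj (i % m) (by simpa using Nat.mod_lt _ hm)
  rw [getElem_seg, zero_add, hperm.map_mod_nat, ← (omegaPow_periodic σ).map_mod_nat, ← hmdef,
    Nat.add_mod_mod] at h
  rw [← h, hmdef, (omegaPow_periodic σ).map_mod_nat]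

end PETC

/-! ## Eigenvectors of mixed matrices -/

section LinearAlgebra

open Filter Topology ComplexConjugate

variable {n : ℕ}

lemma map_ofReal_mulVec_ofReal (T : Matrix (Fin n) (Fin n) ℝ) (x : Fin n → ℝ) :
    T.map Complex.ofReal *ᵥ (fun i => (x i : ℂ)) = fun i => ((T *ᵥ x) i : ℂ) := by
  funext i
  simp [Matrix.mulVec, dotProduct]

lemma re_map_ofReal_mulVec (T : Matrix (Fin n) (Fin n) ℝ) (z : Fin n → ℂ) :
    (fun i => ((T.map Complex.ofReal *ᵥ z) i).re) = T *ᵥ fun i => (z i).re := by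
  funext i
  simp [Matrix.mulVec, dotProduct]

lemma im_map_ofReal_mulVec (T : Matrix (Fin n) (Fin n) ℝ) (z : Fin n → ℂ) :
    (fun i => ((T.map Complex.ofReal *ᵥ z) i).im) = T *ᵥ fun i => (z i).im := by
  funext i
  simp [Matrix.mulVec, dotProduct]

lemma map_ofReal_mul (S T : Matrix (Fin n) (Fin n) ℝ) :
    (S * T).map Complex.ofReal = S.map Complex.ofReal * T.map Complex.ofReal :=
  map_mul Complex.ofRealHom.mapMatrix S T

lemma pow_map_ofReal_mulVec {T : Matrix (Fin n) (Fin n) ℝ} {z : Fin n → ℂ} {a : ℂ}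
    (h : T.map Complex.ofReal *ᵥ z = a • z) (k : ℕ) :
    (T ^ k).map Complex.ofReal *ᵥ z = a ^ k • z := by
  induction k with
  | zero => simp [Matrix.map_one]
  | succ k ih =>
    rw [pow_succ', map_ofReal_mul, ← Matrix.mulVec_mulVec, ih, Matrix.mulVec_smul, h, smul_smul,
      pow_succ]

lemma conj_map_ofReal_mulVec {T : Matrix (Fin n) (Fin n) ℝ} {z : Fin n → ℂ} {a : ℂ}
    (h : T.map Complex.ofReal *ᵥ z = a • z) :
    T.map Complex.ofReal *ᵥ (fun i => conj (z i)) = conj a • fun i => conj (z i) := by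
  funext i
  have := congrArg conj (congrFun h i)
  simpa [Matrix.mulVec, dotProduct] using this

/-- Two equal eigenvalues would be conjugate to each other, hence real, which mixedness forbids. So
a mixed matrix has simple spectrum. -/
lemma injective_of_mixed {a : Fin n → ℂ}
    (h : ∀ i j, i ≠ j → ‖a i‖ = ‖a j‖ → (a i).im ≠ 0 ∧ a i = conj (a j)) :
    Function.Injective a := by
  intro i j he
  by_contra hij
  obtain ⟨h₁, h₂⟩ := h i j hij (by rw [he])
  rw [← he] at h₂
  exact h₁ (Complex.conj_eq_iff_im.1 h₂.symm)

lemma exists_eigenbasis {T : Matrix (Fin n) (Fin n) ℝ} (h : IsMixed T) :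
    ∃ (a : Fin n → ℂ) (v : Module.Basis (Fin n) ℂ (Fin n → ℂ)),
      (∀ i, T.map Complex.ofReal *ᵥ v i = a i • v i) ∧ (∀ i, a i ∈ eigenvaluesC T) ∧
      ∀ i j, i ≠ j → ‖a i‖ = ‖a j‖ → (a i).im ≠ 0 ∧ a i = conj (a j) := by
  obtain ⟨l, hl, hp⟩ := h
  have hlen : l.length = n := by
    have h₁ : Multiset.card (eigenvaluesC T) = n := by
      rw [eigenvaluesC, Polynomial.splits_iff_card_roots.1 (IsAlgClosed.splits _),
        Matrix.charpoly_natDegree_eq_dim, Fintype.card_fin]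
    rw [hl] at h₁; simpa using h₁
  let a : Fin n → ℂ := fun i => l.get (Fin.cast hlen.symm i)
  have hmem : ∀ i, a i ∈ eigenvaluesC T := fun i => by
    rw [hl]; exact Multiset.mem_coe.2 (List.get_mem _ _)
  have hpair : ∀ i j, i ≠ j → ‖a i‖ = ‖a j‖ → (a i).im ≠ 0 ∧ a i = conj (a j) := by
    intro i j hij he
    rw [List.pairwise_iff_get] at hp
    rcases lt_or_gt_of_ne hij with h | h
    · exact hp (Fin.cast hlen.symm i) (Fin.cast hlen.symm j) h he
    · obtain ⟨h₁, h₂⟩ := hp (Fin.cast hlen.symm j) (Fin.cast hlen.symm i) h he.symm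
      change (a j).im ≠ 0 at h₁
      change a j = conj (a i) at h₂
      refine ⟨fun h0 => h₁ (by rw [h₂]; simp [h0]), by rw [h₂]; simp⟩
  have hinj := injective_of_mixed hpair
  have hex : ∀ i, ∃ v : Fin n → ℂ, v ≠ 0 ∧ T.map Complex.ofReal *ᵥ v = a i • v := by
    intro i
    have hroot := Polynomial.isRoot_of_mem_roots (hmem i)
    rw [Polynomial.IsRoot, Matrix.eval_charpoly] at hroot
    obtain ⟨v, hv, hv'⟩ := Matrix.exists_mulVec_eq_zero_iff.2 hroot
    refine ⟨v, hv, ?_⟩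
    rw [Matrix.sub_mulVec, sub_eq_zero] at hv'
    rw [← hv']
    simp [Matrix.scalar_apply, ← Matrix.smul_one_eq_diagonal, Matrix.smul_mulVec]
  choose v hv hTv using hex
  have hli : LinearIndependent ℂ v :=
    Module.End.eigenvectors_linearIndependent' (T.map Complex.ofReal).mulVecLin a hinj v fun i =>
      ⟨Module.End.mem_eigenspace_iff.2 (by simpa using hTv i), hv i⟩
  have hspan : ⊤ ≤ Submodule.span ℂ (Set.range v) :=
    (hli.span_eq_top_of_card_eq_finrank' (by simp)).ge
  exact ⟨a, Module.Basis.mk hli hspan, fun i => by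
    rw [Module.Basis.mk_apply]; exact hTv i, hmem, hpair⟩

lemma exists_eq_smul_basis {T : Matrix (Fin n) (Fin n) ℝ} {a : Fin n → ℂ}
    {v : Module.Basis (Fin n) ℂ (Fin n → ℂ)} (hv : ∀ i, T.map Complex.ofReal *ᵥ v i = a i • v i)
    (hinj : Function.Injective a) {b : ℂ} {z : Fin n → ℂ} (hz : z ≠ 0)
    (h : T.map Complex.ofReal *ᵥ z = b • z) : ∃ (j : Fin n) (c : ℂ), c ≠ 0 ∧ b = a j ∧ z = c • v j := by
  have hcoef : ∀ j, a j * v.repr z j = b * v.repr z j := by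
    intro j
    have h₁ : T.map Complex.ofReal *ᵥ z = ∑ i, (a i * v.repr z i) • v i := by
      conv_lhs => rw [← v.sum_repr z]
      rw [Matrix.mulVec_sum]
      exact Finset.sum_congr rfl fun i _ => by
        rw [Matrix.mulVec_smul, hv, smul_smul, mul_comm]
    have h₂ := congrArg (fun w => v.repr w j) (h₁.symm.trans h)
    have h₃ := congrFun (v.repr_sum_self fun i => a i * v.repr z i) j
    rw [← h₃]
    simpa using h₂
  obtain ⟨j, hj⟩ : ∃ j, v.repr z j ≠ 0 := by
    by_contra! h0
    exact hz (v.ext_elem fun i => by simp [h0 i])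
  have hb : ∀ i, v.repr z i ≠ 0 → a i = b := fun i hi => mul_right_cancel₀ hi (hcoef i)
  refine ⟨j, v.repr z j, hj, (hb j hj).symm, ?_⟩
  conv_lhs => rw [← v.sum_repr z]
  refine Finset.sum_eq_single j (fun i _ hij => ?_) (by simp)
  have : v.repr z i = 0 := by
    by_contra h0
    exact hij (hinj ((hb i h0).trans (hb j hj).symm))
  rw [this, zero_smul]

/-- Simple spectrum makes every complex eigenspace one-dimensional. -/
lemma IsMixed.exists_eq_smul {T : Matrix (Fin n) (Fin n) ℝ} (hT : IsMixed T) {b : ℂ}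
    {z z' : Fin n → ℂ} (hz : z ≠ 0) (h : T.map Complex.ofReal *ᵥ z = b • z)
    (h' : T.map Complex.ofReal *ᵥ z' = b • z') : ∃ c : ℂ, z' = c • z := by
  obtain ⟨a, v, hv, -, hpair⟩ := exists_eigenbasis hT
  have hinj := injective_of_mixed hpair
  rcases eq_or_ne z' 0 with rfl | hz'
  · exact ⟨0, by simp⟩
  obtain ⟨j, c, hc, rfl, rfl⟩ := exists_eq_smul_basis hv hinj hz h
  obtain ⟨j', c', -, hj', rfl⟩ := exists_eq_smul_basis hv hinj hz' h'
  obtain rfl := hinj hj'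
  exact ⟨c' / c, by rw [smul_smul, div_mul_cancel₀ _ hc]⟩

lemma IsMixed.mem_eigenvaluesC {T : Matrix (Fin n) (Fin n) ℝ} (hT : IsMixed T) {b : ℂ}
    {z : Fin n → ℂ} (hz : z ≠ 0) (h : T.map Complex.ofReal *ᵥ z = b • z) :
    b ∈ eigenvaluesC T := by
  obtain ⟨a, v, hv, hmem, hpair⟩ := exists_eigenbasis hT
  obtain ⟨j, c, -, rfl, -⟩ := exists_eq_smul_basis hv (injective_of_mixed hpair) hz h
  exact hmem j

/-! ## Basic invariant subspaces -/

/-- Parametrizing the plane by `c ↦ Re (c z)` turns the action of the matrix into multiplication of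
`c` by the eigenvalue. -/
lemma mem_span_re_im_iff {z : Fin n → ℂ} {u : Fin n → ℝ} :
    u ∈ Submodule.span ℝ {fun i => (z i).re, fun i => (z i).im} ↔
      ∃ c : ℂ, (fun i => (c * z i).re) = u := by
  rw [Submodule.mem_span_pair]
  constructor
  · rintro ⟨s, t, rfl⟩
    exact ⟨⟨s, -t⟩, by funext i; simp⟩
  · rintro ⟨c, rfl⟩
    exact ⟨c.re, -c.im, by funext i; simp; ring⟩

/-- If `w = c z` had zero real part, so would its image `a w`, the matrix being real. But then `Re
(a w) = -Im a · Im w`, which forces `w = 0`. -/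
lemma re_smul_ne_zero {T : Matrix (Fin n) (Fin n) ℝ} {a c : ℂ} {z : Fin n → ℂ} (ha : a.im ≠ 0)
    (hz : z ≠ 0) (h : T.map Complex.ofReal *ᵥ z = a • z) (hc : c ≠ 0) :
    (fun i => (c * z i).re) ≠ 0 := by
  intro h0
  have h₁ : T.map Complex.ofReal *ᵥ (c • z) = a • (c • z) := by
    rw [Matrix.mulVec_smul, h, smul_comm]
  have h₂ := re_map_ofReal_mulVec T (c • z)
  have h₃ : (fun i => ((c • z) i).re) = 0 := h0
  rw [h₁, h₃, Matrix.mulVec_zero] at h₂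
  refine hz (funext fun i => ?_)
  have h₄ := congrFun h₂ i
  have h₅ : (c * z i).re = 0 := congrFun h0 i
  simp only [Pi.smul_apply, smul_eq_mul, Complex.mul_re a, h₅, mul_zero, zero_sub,
    Pi.zero_apply, neg_eq_zero, mul_eq_zero, ha, false_or] at h₄
  exact (mul_eq_zero.1 (Complex.ext h₅ h₄)).resolve_left hc

lemma exists_ne_zero_of_mem_basicInvariantSubspaces {n : ℕ} {T : Matrix (Fin n) (Fin n) ℝ}
    {V : Submodule ℝ (Fin n → ℝ)} (hV : V ∈ basicInvariantSubspaces T) : ∃ x ∈ V, x ≠ 0 := by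
  rcases hV with ⟨v, a, hv, -, rfl⟩ | ⟨z, a, ha, hz, hTz, rfl⟩
  · exact ⟨v, Submodule.mem_span_singleton_self v, hv⟩
  · exact ⟨_, mem_span_re_im_iff.2 ⟨1, rfl⟩, re_smul_ne_zero ha hz hTz one_ne_zero⟩

lemma mulVec_mem_of_mem_basicInvariantSubspaces {n : ℕ} {T : Matrix (Fin n) (Fin n) ℝ}
    {V : Submodule ℝ (Fin n → ℝ)} (hV : V ∈ basicInvariantSubspaces T) {x : Fin n → ℝ}
    (hx : x ∈ V) : T *ᵥ x ∈ V := by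
  rcases hV with ⟨v, a, -, hv, rfl⟩ | ⟨z, a, -, -, hz, rfl⟩
  · obtain ⟨s, rfl⟩ := Submodule.mem_span_singleton.1 hx
    rw [Matrix.mulVec_smul, hv]
    exact Submodule.smul_mem _ _ (Submodule.smul_mem _ _ (Submodule.mem_span_singleton_self v))
  · obtain ⟨c, rfl⟩ := mem_span_re_im_iff.1 hx
    refine mem_span_re_im_iff.2 ⟨c * a, ?_⟩
    have := re_map_ofReal_mulVec T (c • z)
    rw [Matrix.mulVec_smul, hz, smul_smul] at this
    exact this

/-- If a basic invariant subspace avoids the frontier of a set invariant under nonzero scalings and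
has a nonzero point in its closure, then all its nonzero points are in the set. -/
lemma subset_of_frontier_disjoint {T : Matrix (Fin n) (Fin n) ℝ}
    {V : Submodule ℝ (Fin n → ℝ)} (hV : V ∈ basicInvariantSubspaces T) {C : Set (Fin n → ℝ)}
    (hC : ∀ c : ℝ, c ≠ 0 → ∀ x ∈ C, c • x ∈ C)
    (hfr : ∀ x ∈ V, x ≠ 0 → x ∉ frontier C) {y : Fin n → ℝ} (hyV : y ∈ V) (hy : y ≠ 0)
    (hyC : y ∈ closure C) : (V : Set (Fin n → ℝ)) \ {0} ⊆ C := by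
  have hyC' : y ∈ C := by
    by_contra hn
    exact hfr y hyV hy ⟨hyC, fun hi => hn (interior_subset hi)⟩
  rcases hV with ⟨v, a, hv, -, rfl⟩ | ⟨z, a, ha, hz, hTz, rfl⟩
  · rintro x ⟨hx, hx0⟩
    obtain ⟨s, rfl⟩ := Submodule.mem_span_singleton.1 hyV
    obtain ⟨t, rfl⟩ := Submodule.mem_span_singleton.1 hx
    have hs : s ≠ 0 := by rintro rfl; simp at hy
    have ht : t ≠ 0 := by rintro rfl; simp at hx0
    have := hC (t / s) (div_ne_zero ht hs) _ hyC'
    rwa [smul_smul, div_mul_cancel₀ _ hs] at this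
  · set V := Submodule.span ℝ {fun i => (z i).re, fun i => (z i).im} with hVdef
    -- The punctured plane is a continuous image of the punctured complex plane, hence connected. A
    -- punctured line is not, so scaling replaced connectedness in that case.
    have himg : (V : Set (Fin n → ℝ)) \ {0} =
        (fun (c : ℂ) (i : Fin n) => (c * z i).re) '' {0}ᶜ := by
      ext u
      constructor
      · rintro ⟨hu, hu0⟩
        obtain ⟨c, rfl⟩ := mem_span_re_im_iff.1 hu
        refine ⟨c, ?_, rfl⟩
        rintro rfl
        exact hu0 (by funext i; simp)
      · rintro ⟨c, hc, rfl⟩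
        exact ⟨mem_span_re_im_iff.2 ⟨c, rfl⟩, re_smul_ne_zero ha hz hTz hc⟩
    have hcon : IsPreconnected ((V : Set (Fin n → ℝ)) \ {0}) := by
      rw [himg]
      refine (isConnected_compl_singleton_of_one_lt_rank
        (Complex.rank_real_complex ▸ Nat.one_lt_ofNat) (0 : ℂ)).isPreconnected.image _ ?_
      fun_prop
    by_contra hsub
    obtain ⟨u, hu, huC⟩ := Set.not_subset.1 hsub
    have hmem : ∀ x ∈ (V : Set (Fin n → ℝ)) \ {0}, x ∈ closure C → x ∈ interior C := by
      rintro x ⟨hxV, hx0⟩ hx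
      by_contra hn
      exact hfr x hxV hx0 ⟨hx, hn⟩
    obtain ⟨x, -, hx, hx'⟩ := hcon (interior C) (closure C)ᶜ isOpen_interior
      isClosed_closure.isOpen_compl
      (fun x hx => (em (x ∈ closure C)).imp (hmem x hx) id)
      ⟨y, ⟨hyV, hy⟩, hmem y ⟨hyV, hy⟩ hyC⟩
      ⟨u, hu, fun hc => huC (interior_subset (hmem u hu hc))⟩
    exact hx' (subset_closure (interior_subset hx))

/-- A nonzero orbit of a nonsingular mixed matrix accumulates in direction at
a nonzero point of a basic invariant subspace. -/
lemma exists_tendsto_basicInvariantSubspace {T : Matrix (Fin n) (Fin n) ℝ} (hT : IsMixed T)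
    (hdet : T.det ≠ 0) {x : Fin n → ℝ} (hx : x ≠ 0) :
    ∃ V ∈ basicInvariantSubspaces T, ∃ y ∈ V, y ≠ 0 ∧ ∃ (φ : ℕ → ℕ) (s : ℕ → ℝ),
      (∀ k, s k ≠ 0) ∧ Tendsto (fun k => s k • (T ^ φ k *ᵥ x)) atTop (𝓝 y) := by
  obtain ⟨a, v, hv, -, hpair⟩ := exists_eigenbasis hT
  have hinj := injective_of_mixed hpair
  set X : Fin n → ℂ := fun i => (x i : ℂ) with hX
  set c : Fin n → ℂ := fun j => v.repr X j with hc
  have hpow : ∀ k : ℕ, (fun i => ((T ^ k *ᵥ x) i : ℂ)) = ∑ j, (c j * a j ^ k) • v j := by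
    intro k
    rw [← map_ofReal_mulVec_ofReal, ← hX]
    conv_lhs => rw [← v.sum_repr X]
    rw [Matrix.mulVec_sum]
    exact Finset.sum_congr rfl fun j _ => by
      rw [Matrix.mulVec_smul, pow_map_ofReal_mulVec (hv j), smul_smul]
  have hne : (Finset.univ.filter fun j => c j ≠ 0).Nonempty := by
    by_contra! h0
    have h0' : ∀ j, c j = 0 := by
      intro j
      have := Finset.notMem_empty j
      rw [← h0] at this
      simpa using this
    refine hx (funext fun i => ?_)
    have h₁ : X = 0 := v.ext_elem fun j => by simpa using h0' j
    exact Complex.ofReal_eq_zero.1 (congrFun h₁ i)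
  -- The dominant eigenvalue among those that occur in the expansion of `x`.
  obtain ⟨j₀, hj₀, hmax⟩ := Finset.exists_max_image _ (fun j => ‖a j‖) hne
  simp only [Finset.mem_filter, Finset.mem_univ, true_and] at hj₀ hmax
  set μ : ℝ := ‖a j₀‖ with hμ
  have hμ0 : 0 < μ := by
    rw [hμ, norm_pos_iff]
    intro h0
    have h₁ := hv j₀
    rw [h0, zero_smul] at h₁
    have hdet' : (T.map Complex.ofReal).det ≠ 0 := by
      have : (T.map Complex.ofReal).det = T.det := (RingHom.map_det Complex.ofRealHom T).symm
      rw [this]; exact_mod_cast hdet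
    exact v.ne_zero j₀ (Matrix.eq_zero_of_mulVec_eq_zero hdet' h₁)
  obtain ⟨ω, hω, φ, hφ, hlim⟩ := (isCompact_sphere (0 : ℂ) 1).tendsto_subseq
    (x := fun k => (a j₀ / μ) ^ k) fun k => by
      simp [← hμ, abs_of_pos hμ0, div_self hμ0.ne']
  have hω1 : ‖ω‖ = 1 := by simpa using hω
  have hω0 : ω ≠ 0 := by rintro rfl; simp at hω1
  -- Limit coefficients after division by `μ ^ φ k`. Smaller moduli die out; by mixedness the only
  -- other eigenvalue of modulus `μ` is the conjugate of `a j₀`, whose normalized powers tend to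
  -- `conj ω` along the same subsequence.
  let d : Fin n → ℂ := fun j => if c j = 0 ∨ ‖a j‖ < μ then 0 else
    if j = j₀ then c j * ω else c j * conj ω
  have hd₀ : d j₀ ≠ 0 := by
    simp [d, hj₀, hω0, ← hμ]
  have hdj : ∀ j, j ≠ j₀ → d j ≠ 0 → (a j).im ≠ 0 ∧ a j = conj (a j₀) := by
    intro j hj hdj
    have h₁ : ¬ (c j = 0 ∨ ‖a j‖ < μ) := fun h => hdj (if_pos h)
    push Not at h₁
    exact hpair j j₀ hj (le_antisymm (hmax j h₁.1) h₁.2)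
  have hterm : ∀ j, Tendsto (fun k => c j * (a j / μ) ^ φ k) atTop (𝓝 (d j)) := by
    intro j
    by_cases h0 : c j = 0
    · simp [d, h0]
    by_cases hlt : ‖a j‖ < μ
    · have h₁ : Tendsto (fun k => (a j / (μ : ℂ)) ^ φ k) atTop (𝓝 0) := by
        refine (tendsto_pow_atTop_nhds_zero_of_norm_lt_one ?_).comp hφ.tendsto_atTop
        rw [norm_div, Complex.norm_real, Real.norm_of_nonneg hμ0.le, div_lt_one hμ0]
        exact hlt
      simpa [d, hlt] using h₁.const_mul (c j)
    by_cases hj : j = j₀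
    · subst hj
      simpa [d, h0, hlt, Function.comp_def] using hlim.const_mul (c j)
    · have h₁ := (hpair j j₀ hj (le_antisymm (hmax j h0) (not_lt.1 hlt))).2
      have h₂ := ((Complex.continuous_conj.tendsto ω).comp hlim).const_mul (c j)
      rw [h₁] at hlt ⊢
      simpa [d, hμ, h0, hlt, hj, Function.comp_def, h₁] using h₂
  set Y : Fin n → ℂ := ∑ j, d j • v j with hY
  have hlimY : Tendsto (fun k => ∑ j, (c j * (a j / μ) ^ φ k) • v j) atTop (𝓝 Y) :=
    tendsto_finsetSum _ fun j _ => (hterm j).smul_const (v j)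
  have hF : ∀ k, ∑ j, (c j * (a j / μ) ^ φ k) • v j =
      fun i => ((((μ ^ φ k)⁻¹ • (T ^ φ k *ᵥ x)) i : ℝ) : ℂ) := by
    intro k
    have h₁ : (fun i => ((((μ ^ φ k)⁻¹ • (T ^ φ k *ᵥ x)) i : ℝ) : ℂ)) =
        ((μ : ℂ) ^ φ k)⁻¹ • fun i => ((T ^ φ k *ᵥ x) i : ℂ) := by
      funext i; simp
    rw [h₁, hpow, Finset.smul_sum]
    refine Finset.sum_congr rfl fun j _ => ?_
    rw [smul_smul, div_pow]
    congr 1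
    ring
  simp only [hF] at hlimY
  rw [tendsto_pi_nhds] at hlimY
  set y : Fin n → ℝ := fun i => (Y i).re with hy
  -- `Y` is a limit of real vectors, hence real.
  have hYy : Y = fun i => (y i : ℂ) := by
    funext i
    have h₁ := (Complex.continuous_im.tendsto _).comp (hlimY i)
    have h₂ : (Y i).im = 0 := by
      refine tendsto_nhds_unique h₁ ?_
      simp only [Function.comp_def, Complex.ofReal_im]
      exact tendsto_const_nhds
    exact Complex.ext rfl (by simpa using h₂)
  have hY0 : Y ≠ 0 := by
    intro h0
    have h₁ := v.repr_sum_self d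
    rw [← hY, h0] at h₁
    exact hd₀ (by rw [← h₁]; simp)
  have hy0 : y ≠ 0 := by
    intro h0
    exact hY0 (by rw [hYy, h0]; funext i; simp)
  have hlimy : Tendsto (fun k => (μ ^ φ k)⁻¹ • (T ^ φ k *ᵥ x)) atTop (𝓝 y) := by
    rw [tendsto_pi_nhds]
    intro i
    have h₁ := (Complex.continuous_re.tendsto _).comp (hlimY i)
    simpa only [Function.comp_def, Complex.ofReal_re] using h₁
  suffices h : ∃ V ∈ basicInvariantSubspaces T, y ∈ V by
    obtain ⟨V, hV, hyV⟩ := h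
    exact ⟨V, hV, y, hyV, hy0, φ, fun k => (μ ^ φ k)⁻¹,
      fun k => inv_ne_zero (pow_pos hμ0 _).ne', hlimy⟩
  by_cases him : (a j₀).im = 0
  · refine ⟨Submodule.span ℝ {y}, Or.inl ⟨y, (a j₀).re, hy0, ?_, rfl⟩,
      Submodule.mem_span_singleton_self y⟩
    -- A second surviving term would need a non-real eigenvalue conjugate to the real `a j₀`.
    have hYe : Y = d j₀ • v j₀ := by
      refine Finset.sum_eq_single j₀ (fun j _ hj => ?_) (by simp)
      by_contra h0
      obtain ⟨h₁, h₂⟩ := hdj j hj fun h => h0 (by rw [h, zero_smul])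
      exact h₁ (by rw [h₂]; simp [him])
    have hTY : T.map Complex.ofReal *ᵥ Y = a j₀ • Y := by
      rw [hYe, Matrix.mulVec_smul, hv, smul_comm]
    rw [← re_map_ofReal_mulVec, hTY]
    funext i
    simp [hy, him]
  · refine ⟨_, Or.inr ⟨v j₀, a j₀, him, v.ne_zero j₀, hv j₀, rfl⟩, ?_⟩
    have hysum : y = ∑ j, fun i => ((d j) * v j i).re := by
      funext i; simp [hy, hY]
    rw [hysum]
    refine Submodule.sum_mem _ fun j _ => mem_span_re_im_iff.2 ?_
    by_cases hj : j = j₀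
    · exact ⟨d j, by rw [hj]⟩
    by_cases h0 : d j = 0
    · exact ⟨0, by simp [h0]⟩
    have h₁ := conj_map_ofReal_mulVec (hv j₀)
    have h₂ := hv j
    rw [(hdj j hj h0).2] at h₂
    have hz : (fun i => conj (v j₀ i)) ≠ 0 := by
      intro h
      refine v.ne_zero j₀ (funext fun i => ?_)
      simpa using congrFun h i
    -- The eigenvector of the conjugate eigenvalue is a multiple of `conj (v j₀)`, so its
    -- contribution is the real part of a multiple of `v j₀`.
    obtain ⟨e, he⟩ := hT.exists_eq_smul hz h₁ h₂
    refine ⟨conj (d j * e), funext fun i => ?_⟩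
    rw [he, ← Complex.conj_re]
    simp [mul_assoc]

/-- The imaginary part is `‖a‖ ^ p * sin (p * arg a)`, and the sine vanishes only at integer
multiples of `π`. -/
lemma im_pow_ne_zero {a : ℂ} (ha : Irrational (a.arg / Real.pi)) (ha0 : a ≠ 0) {p : ℕ}
    (hp : 0 < p) : (a ^ p).im ≠ 0 := by
  intro h0
  rw [← Complex.norm_mul_exp_arg_mul_I a, mul_pow, ← Complex.exp_nat_mul, ← mul_assoc,
    ← Complex.ofReal_natCast, ← Complex.ofReal_mul, ← Complex.ofReal_pow, Complex.im_ofReal_mul,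
    Complex.exp_ofReal_mul_I_im] at h0
  have hn : ‖a‖ ^ p ≠ 0 := pow_ne_zero _ (norm_ne_zero_iff.2 ha0)
  obtain ⟨k, hk⟩ := Real.sin_eq_zero_iff.1 ((mul_eq_zero.1 h0).resolve_left hn)
  refine ha ⟨(k : ℚ) / p, ?_⟩
  have hp' : (p : ℝ) ≠ 0 := by exact_mod_cast hp.ne'
  push_cast
  rw [div_eq_div_iff hp' Real.pi_ne_zero, hk, mul_comm]

/-- A matrix that commutes with a mixed matrix of irrational rotations, and has a common power
with it, inherits its basic invariant subspaces. -/
lemma mem_basicInvariantSubspaces_of_commute {T W : Matrix (Fin n) (Fin n) ℝ} (hT : IsMixed T)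
    (hirr : IsIrrationalRotations T) (hcomm : W * T = T * W) {m p : ℕ} (hp : 0 < p)
    (hpow : W ^ m = T ^ p) {V : Submodule ℝ (Fin n → ℝ)} (hV : V ∈ basicInvariantSubspaces T) :
    V ∈ basicInvariantSubspaces W := by
  -- By commutation `W` preserves each eigenspace of `T`, which is a line, and so acts on it as a
  -- scalar.
  have key : ∀ (z : Fin n → ℂ) (a : ℂ), z ≠ 0 → T.map Complex.ofReal *ᵥ z = a • z →
      ∃ b : ℂ, W.map Complex.ofReal *ᵥ z = b • z := by
    intro z a hz h
    refine hT.exists_eq_smul hz h ?_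
    rw [Matrix.mulVec_mulVec, ← map_ofReal_mul, ← hcomm, map_ofReal_mul, ← Matrix.mulVec_mulVec, h,
      Matrix.mulVec_smul]
  rcases hV with ⟨v, a, hv, hTv, rfl⟩ | ⟨z, a, ha, hz, hTz, rfl⟩
  · obtain ⟨b, hb⟩ := key (fun i => (v i : ℂ)) a
      (fun h => hv (funext fun i => Complex.ofReal_eq_zero.1 (congrFun h i)))
      (by rw [map_ofReal_mulVec_ofReal, hTv]; funext i; simp)
    refine Or.inl ⟨v, b.re, hv, ?_, rfl⟩
    have := re_map_ofReal_mulVec W (fun i => (v i : ℂ))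
    rw [hb] at this
    simp only [Complex.ofReal_re] at this
    rw [← this]
    funext i; simp
  · obtain ⟨b, hb⟩ := key z a hz hTz
    -- A real `b` would make `a ^ p = b ^ m` real, against irrationality of the rotation.
    refine Or.inr ⟨z, b, fun hb0 => ?_, hz, hb, rfl⟩
    have h₁ := pow_map_ofReal_mulVec hb m
    rw [hpow, pow_map_ofReal_mulVec hTz p] at h₁
    have h₂ : a ^ p = b ^ m := smul_left_injective ℂ hz h₁
    have ha0 : a ≠ 0 := by rintro rfl; simp at ha
    refine im_pow_ne_zero (hirr a (hT.mem_eigenvaluesC hz hTz) ha) ha0 hp ?_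
    have hb' : b = (b.re : ℂ) := Complex.ext rfl (by simpa using hb0)
    rw [h₂, hb', ← Complex.ofReal_pow, Complex.ofReal_im]

lemma map_mem_basicInvariantSubspaces {G M W : Matrix (Fin n) (Fin n) ℝ} (hG : G.det ≠ 0)
    (h : M * G = G * W) {V : Submodule ℝ (Fin n → ℝ)} (hV : V ∈ basicInvariantSubspaces W) :
    V.map G.mulVecLin ∈ basicInvariantSubspaces M := by
  rcases hV with ⟨v, a, hv, hWv, rfl⟩ | ⟨z, a, ha, hz, hWz, rfl⟩
  · refine Or.inl ⟨G *ᵥ v, a, fun h0 => hv (Matrix.eq_zero_of_mulVec_eq_zero hG h0), ?_, ?_⟩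
    · rw [Matrix.mulVec_mulVec, h, ← Matrix.mulVec_mulVec, hWv, Matrix.mulVec_smul]
    · rw [Submodule.map_span, Set.image_singleton]; rfl
  · have hG' : (G.map Complex.ofReal).det ≠ 0 := by
      have : (G.map Complex.ofReal).det = G.det := (RingHom.map_det Complex.ofRealHom G).symm
      rw [this]; exact_mod_cast hG
    refine Or.inr ⟨G.map Complex.ofReal *ᵥ z, a, ha,
      fun h0 => hz (Matrix.eq_zero_of_mulVec_eq_zero hG' h0), ?_, ?_⟩
    · rw [Matrix.mulVec_mulVec, ← map_ofReal_mul, h, map_ofReal_mul, ← Matrix.mulVec_mulVec, hWz,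
        Matrix.mulVec_smul]
    · rw [Submodule.map_span, Set.image_pair, re_map_ofReal_mulVec, im_map_ofReal_mulVec]; rfl

/-- A common nonzero point would have normalized distance `1 - 1 = 0` to itself. -/
lemma notMem_of_le_normalizedSetDist {C D : Set (Fin n → ℝ)} {ε : ℝ} (hε : 0 < ε)
    (h : (ε : EReal) ≤ normalizedSetDist C D) {x : Fin n → ℝ} (hx : x ∈ C) (hx0 : x ≠ 0) :
    x ∉ D := by
  intro hxD
  have h₁ : normalizedSetDist C D ≤
      ((1 - (x ⬝ᵥ x) / (euclNorm x * euclNorm x) : ℝ) : EReal) :=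
    (iInf₂_le x ⟨hx, hx0⟩).trans (iInf₂_le x ⟨hxD, hx0⟩)
  have h₂ : x ⬝ᵥ x = euclNorm x * euclNorm x := by
    rw [euclNorm, ← sq, EuclideanSpace.real_norm_sq_eq]
    simp [dotProduct, sq]
  have h₃ : euclNorm x * euclNorm x ≠ 0 := by
    rw [← h₂]; exact fun h => hx0 (dotProduct_self_eq_zero.1 h)
  rw [h₂, div_self h₃, sub_self] at h₁
  have := h.trans h₁
  exact absurd (EReal.coe_le_coe_iff.1 this) (not_le.2 hε)

end LinearAlgebra

namespace PETC

variable {nx nu : ℕ} (P : PETC nx nu)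

/-! ## Cones and verification -/

/-- Membership depends on signs of quadratic forms, which scale by `c ^ 2`; negative `c` is
therefore allowed. -/
lemma smul_mem_setQ {c : ℝ} (hc : c ≠ 0) {k : ℕ} {x : Fin nx → ℝ} (hx : x ∈ P.setQ k) :
    c • x ∈ P.setQ k := by
  have hK : ∀ j, c • x ∈ P.setK j ↔ x ∈ P.setK j := by
    intro j
    have h : (c • x) ⬝ᵥ P.N j *ᵥ (c • x) = (c * c) * (x ⬝ᵥ P.N j *ᵥ x) := by
      rw [Matrix.mulVec_smul, dotProduct_smul, smul_dotProduct, smul_eq_mul, smul_eq_mul, mul_assoc]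
    simp only [setK, Set.mem_ofPred_eq]
    rw [h, mul_pos_iff_of_pos_left (mul_self_pos.2 hc)]
  obtain ⟨h₁, h₂, h₃, h₄⟩ := hx
  exact ⟨h₁, h₂, (hK k).2 h₃, fun j hj hjk h => h₄ j hj hjk ((hK j).1 h)⟩

lemma smul_mem_cone {c : ℝ} (hc : c ≠ 0) {w : List ℕ} {x : Fin nx → ℝ} (hx : x ∈ P.cone w) :
    c • x ∈ P.cone w := by
  induction w generalizing x with
  | nil => trivial
  | cons k w ih =>
    refine ⟨P.smul_mem_setQ hc hx.1, ?_⟩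
    rw [Matrix.mulVec_smul]
    exact ih hx.2

lemma verified_of_subset_cone {V : Submodule ℝ (Fin nx → ℝ)} {w : List ℕ}
    (h : ∀ x ∈ V, x ≠ 0 → x ∈ P.cone w) : P.Verified V w := by
  induction w generalizing V with
  | nil => trivial
  | cons k w ih =>
    refine ⟨fun x hx => (h x hx.1 hx.2).1, ih ?_⟩
    rintro _ ⟨x, hx, rfl⟩ hne
    exact (h x hx fun h0 => hne (by rw [h0, map_zero])).2

/-- The test discards zero from every image; nonsingularity keeps nonzero points nonzero along the
word, so each stage of the test applies to them. -/
lemma Verified.mem_cone {V : Submodule ℝ (Fin nx → ℝ)} {w : List ℕ} (h : P.Verified V w)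
    (hdet : (P.wordM w).det ≠ 0) {x : Fin nx → ℝ} (hx : x ∈ V) (hne : x ≠ 0) : x ∈ P.cone w := by
  induction w generalizing V x with
  | nil => trivial
  | cons k w ih =>
    rw [wordM, Matrix.det_mul] at hdet
    refine ⟨h.1 ⟨hx, hne⟩, ih h.2 (left_ne_zero_of_mul hdet) (Submodule.mem_map_of_mem hx) ?_⟩
    exact fun h0 => hne (Matrix.eq_zero_of_mulVec_eq_zero (right_ne_zero_of_mul hdet) h0)

lemma iterate_succ_of_mem_cone {x : Fin nx → ℝ} {w : List ℕ} (hx : x ∈ P.cone w) :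
    P.succ^[w.length] x = P.wordM w *ᵥ x := by
  rw [iterate_succ_eq, P.mem_cone_iff.1 hx]

/-- The nonzero points of an invariant subspace inside the cone of `w` have trace `w^ω`. -/
lemma trace_eq_omegaPow {V : Submodule ℝ (Fin nx → ℝ)} {w : List ℕ} (hw : w ≠ [])
    (hdet : (P.wordM w).det ≠ 0) (hV : V ∈ basicInvariantSubspaces (P.wordM w))
    (hc : ∀ x ∈ V, x ≠ 0 → x ∈ P.cone w) {x : Fin nx → ℝ} (hx : x ∈ V) (hne : x ≠ 0) :
    P.trace x = omegaPow w := by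
  have hp : 0 < w.length := List.length_pos_iff.2 hw
  have hit : ∀ q : ℕ, P.succ^[q * w.length] x ∈ V ∧ P.succ^[q * w.length] x ≠ 0 := by
    intro q
    induction q with
    | zero => simpa using ⟨hx, hne⟩
    | succ q ih =>
      rw [add_mul, one_mul, add_comm, Function.iterate_add_apply,
        P.iterate_succ_of_mem_cone (hc _ ih.1 ih.2)]
      exact ⟨mulVec_mem_of_mem_basicInvariantSubspaces hV ih.1,
        fun h0 => ih.2 (Matrix.eq_zero_of_mulVec_eq_zero hdet h0)⟩
  funext i
  have h₁ := hc _ (hit (i / w.length)).1 (hit (i / w.length)).2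
  rw [← seg_omegaPow w, P.mem_cone_seg] at h₁
  have h₂ := h₁ (i % w.length) (Nat.mod_lt _ hp)
  rwa [seg_omegaPow, trace_iterate, Nat.div_add_mod', zero_add,
    (omegaPow_periodic w).map_mod_nat] at h₂

/-- A verified smallest-in-average cycle yields the smallest average inter-sample time. -/
lemma smallestValue_eq_of_verified {l : ℕ} (hl : 1 ≤ l) {w : List ℕ}
    (hw : w ∈ (P.completeModel l).sacWords) (hdet : (P.wordM w).det ≠ 0)
    {V : Submodule ℝ (Fin nx → ℝ)} (hV : V ∈ basicInvariantSubspaces (P.wordM w))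
    (hver : P.Verified V w) :
    (P.completeModel l).smallestValue = P.traffic.smallestValue := by
  obtain ⟨hne, -, hval⟩ := (P.mem_sacWords_iff hl).1 hw
  refine le_antisymm (P.smallestValue_completeModel_le_traffic hl) ?_
  obtain ⟨x, hx, hx0⟩ := exists_ne_zero_of_mem_basicInvariantSubspaces hV
  rw [← hval, ← P.trace_eq_omegaPow hne hdet hV
    (fun x hx hx0 => Verified.mem_cone P hver hdet hx hx0) hx hx0]
  exact P.smallestValue_traffic_le x

/-! ## Basic invariant subspaces realizing the isolated cycle -/

lemma wordM_seg_mul {y : ℕ → ℕ} {m : ℕ} (hy : Function.Periodic y m) (i q : ℕ) :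
    P.wordM (seg y i (q * m)) = P.wordM (seg y i m) ^ q := by
  induction q with
  | zero => simp [seg, wordM]
  | succ q ih =>
    have h : seg y (i + q * m) m = seg y i m := seg_congr fun t _ => by
      rw [add_right_comm, ← smul_eq_mul]; exact hy.nsmul q _
    rw [add_mul, one_mul, seg_add, wordM_append, ih, h, pow_succ']

/-- The rescaled orbit of `x` stays in the cone, so its limit lies in the closure; clearance then
forces the whole punctured subspace into the cone. -/
lemma exists_basicInvariantSubspace_subset_cone {σ : List ℕ} (hreg : P.IsRegular σ)
    {x : Fin nx → ℝ} (hx : x ≠ 0) (htr : P.trace x = omegaPow σ) :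
    ∃ V ∈ basicInvariantSubspaces (P.wordM σ), ∀ x ∈ V, x ≠ 0 → x ∈ P.cone σ := by
  obtain ⟨V, hV, y, hyV, hy0, φ, s, hs, hlim⟩ :=
    exists_tendsto_basicInvariantSubspace hreg.mixed hreg.nonsingular hx
  obtain ⟨ε, hε, hclear⟩ := hreg.clearance V hV
  have horbit : ∀ q, P.wordM σ ^ q *ᵥ x ∈ P.cone σ := by
    intro q
    have h₁ : P.succ^[q * σ.length] x = P.wordM σ ^ q *ᵥ x := by
      rw [iterate_succ_eq, htr, P.wordM_seg_mul (omegaPow_periodic σ), seg_omegaPow]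
    rw [← h₁, ← seg_omegaPow σ, mem_cone_seg, seg_omegaPow]
    intro t _
    rw [trace_iterate, htr, add_comm (q * σ.length), zero_add, ← smul_eq_mul]
    exact (omegaPow_periodic σ).nsmul q t
  have hsub := subset_of_frontier_disjoint hV (fun c hc x hx => P.smul_mem_cone hc hx)
    (fun x hxV hx0 => notMem_of_le_normalizedSetDist hε hclear hxV hx0) hyV hy0
    (mem_closure_of_tendsto hlim (Filter.Eventually.of_forall fun k =>
      P.smul_mem_cone (hs k) (horbit (φ k))))
  exact ⟨V, hV, fun x hxV hx0 => hsub ⟨hxV, hx0⟩⟩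

/-- A cycle word that is a rotation of a regular word, up to repetition, passes the test. -/
lemma exists_verified_of_rotation {σ w : List ℕ} (hσ : σ ≠ []) (hw : w ≠ [])
    (hreg : P.IsRegular σ)
    (hne : ∃ x : Fin nx → ℝ, x ≠ 0 ∧ P.trace x = omegaPow σ) {j : ℕ}
    (hj : ∀ i, omegaPow w i = omegaPow σ (j + i)) :
    ∃ V ∈ basicInvariantSubspaces (P.wordM w), P.Verified V w := by
  obtain ⟨x, hx, htr⟩ := hne
  obtain ⟨V, hV, hVc⟩ := P.exists_basicInvariantSubspace_subset_cone hreg hx htr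
  have hp : 0 < w.length := List.length_pos_iff.2 hw
  have hm : 0 < σ.length := List.length_pos_iff.2 hσ
  set Y := omegaPow σ with hY
  set y := omegaPow w with hy
  have hYm : Function.Periodic Y σ.length := omegaPow_periodic σ
  have hyp : Function.Periodic y w.length := omegaPow_periodic w
  have hym : Function.Periodic y σ.length := fun i => by
    rw [hj, hj, ← add_assoc, hYm]
  set T := P.wordM σ with hT
  set G := P.wordM (seg Y 0 j) with hG
  set S := P.wordM (seg y 0 σ.length) with hS
  set W := P.wordM w with hW
  -- The first `j + σ.length` letters of $\sigma^\omega$ split in two ways: `σ` then the prefix of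
  -- length `j`, or that prefix then the shifted period. Commutation of `W` and `S` below arises in
  -- the same way.
  have hGT : SemiconjBy G T S := by
    have h₁ : seg y 0 σ.length = seg Y j σ.length := seg_congr fun t _ => by rw [zero_add, hj]
    have h₂ : seg Y (0 + σ.length) j = seg Y 0 j := seg_congr fun t _ => by
      rw [add_right_comm, hYm]
    have h₃ := seg_add Y 0 j σ.length
    rw [add_comm, seg_add, h₂, hY, seg_omegaPow, ← hY, zero_add, ← h₁] at h₃
    have h₄ := congrArg P.wordM h₃
    rwa [wordM_append, wordM_append] at h₄
  have hWS : Commute W S := by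
    have h₁ : seg y (0 + w.length) σ.length = seg y 0 σ.length := seg_congr fun t _ => by
      rw [add_right_comm, hyp]
    have h₂ : seg y (0 + σ.length) w.length = seg y 0 w.length := seg_congr fun t _ => by
      rw [add_right_comm, hym]
    have h₃ := seg_add y 0 σ.length w.length
    rw [add_comm, seg_add, h₁, h₂, hy, seg_omegaPow, ← hy] at h₃
    have h₄ := congrArg P.wordM h₃
    rw [wordM_append, wordM_append] at h₄
    exact h₄.symm
  have hpow : W ^ σ.length = S ^ w.length := by
    rw [hS, ← P.wordM_seg_mul hym, mul_comm, P.wordM_seg_mul hyp, hy, seg_omegaPow]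
  -- Since `j ≤ j * σ.length`, `G` is a right factor of `T ^ j`.
  have hGdet : G.det ≠ 0 := by
    have h₁ := P.wordM_seg_mul hYm 0 j
    obtain ⟨r, hr⟩ := Nat.exists_eq_add_of_le (Nat.le_mul_of_pos_right j hm)
    rw [hr, seg_add, wordM_append, ← hG, hY, seg_omegaPow] at h₁
    have h₂ := congrArg Matrix.det h₁
    rw [Matrix.det_mul, Matrix.det_pow] at h₂
    exact right_ne_zero_of_mul (h₂.trans_ne (pow_ne_zero _ hreg.nonsingular))
  have hGunit : IsUnit G := (Matrix.isUnit_iff_isUnit_det G).2 (isUnit_iff_ne_zero.2 hGdet)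
  -- Conjugating by `G` pulls `W` back beside `T`, where the two commute and have a common power.
  have hGW : SemiconjBy G (G⁻¹ * W * G) W := by
    rw [SemiconjBy, mul_assoc, ← mul_assoc, Matrix.mul_nonsing_inv _ (isUnit_iff_ne_zero.2 hGdet),
      one_mul]
  have hcomm : G⁻¹ * W * G * T = T * (G⁻¹ * W * G) := by
    refine hGunit.mul_left_cancel ?_
    rw [(hGW.mul_right hGT).eq, (hGT.mul_right hGW).eq, hWS.eq]
  have hpow' : (G⁻¹ * W * G) ^ σ.length = T ^ w.length := by
    refine hGunit.mul_left_cancel ?_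
    rw [(hGW.pow_right _).eq, (hGT.pow_right _).eq, hpow]
  have hV' := mem_basicInvariantSubspaces_of_commute hreg.mixed hreg.irrational hcomm hp hpow' hV
  refine ⟨_, map_mem_basicInvariantSubspaces hGdet hGW.eq.symm hV', P.verified_of_subset_cone ?_⟩
  rintro _ ⟨u, hu, rfl⟩ hne
  have hu0 : u ≠ 0 := fun h0 => hne (by rw [h0, map_zero])
  have htru := P.trace_eq_omegaPow hσ hreg.nonsingular hV hVc hu hu0
  have hGu : G *ᵥ u = P.succ^[j] u := by rw [iterate_succ_eq, htru]
  rw [Matrix.mulVecLin_apply, hGu, ← seg_omegaPow w, mem_cone_seg]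
  intro t _
  rw [trace_iterate, htru, zero_add, ← hy, hj]

/-! ## The algorithm -/

lemma exists_eq_of_reachable {s : AlgConfig} (hns : ∀ l : ℕ, 1 ≤ l →
      ∀ w ∈ (P.completeModel l).sacWords, (P.wordM w).det ≠ 0)
    (h : Relation.ReflTransGen P.AlgStep (.loop 1) s) :
    (∃ l, 1 ≤ l ∧ s = .loop l) ∨ ∃ l Sl w, s = .returned l Sl w P.traffic.smallestValue := by
  induction h with
  | refl => exact Or.inl ⟨1, le_rfl, rfl⟩
  | tail _ hstep ih =>
    rcases ih with ⟨l, hl, rfl⟩ | ⟨l, Sl, w, rfl⟩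
    · cases hstep with
      | ret l w hw V hV hver =>
        refine Or.inr ⟨l, P.completeModel l, w, ?_⟩
        rw [P.smallestValue_eq_of_verified hl hw (hns l hl w hw) hV hver]
      | next l w hw hver => exact Or.inl ⟨l + 1, by omega, rfl⟩
    · cases hstep

lemma exists_step_loop {l : ℕ} (hl : 1 ≤ l) : ∃ s, P.AlgStep (.loop l) s := by
  obtain ⟨w, hw⟩ := P.sacWords_nonempty hl
  by_cases h : ∃ V ∈ basicInvariantSubspaces (P.wordM w), P.Verified V w
  · obtain ⟨V, hV, hver⟩ := h
    exact ⟨_, AlgStep.ret l w hw V hV hver⟩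
  · push Not at h
    exact ⟨_, AlgStep.next l w hw h⟩

/-- A returned configuration has no successor, so an infinite execution only increments the counter.
-/
lemma eq_loop_of_infinite_execution {e : ℕ → AlgConfig} (h0 : e 0 = .loop 1)
    (he : ∀ i, P.AlgStep (e i) (e (i + 1))) (i : ℕ) : e i = .loop (i + 1) := by
  induction i with
  | zero => exact h0
  | succ i ih =>
    have h₁ := he i
    have h₂ := he (i + 1)
    rw [ih] at h₁
    generalize e (i + 1) = s at h₁ h₂
    cases h₁ with
    | ret => cases h₂
    | next => rfl

end PETC

theorem mainTheorem2 {nx nu : ℕ} (P : PETC nx nu) (σ : List ℕ)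
    (hiso : P.traffic.IsIsolatedSAC σ)
    (hreg : P.IsRegular σ)
    (hne : ∃ x : Fin nx → ℝ, x ≠ 0 ∧ P.traffic.IsTraceFrom x (omegaPow σ))
    (hns : ∀ l : ℕ, 1 ≤ l → ∀ w ∈ (P.completeModel l).sacWords, (P.wordM w).det ≠ 0) :
    P.AlgTerminatesWith P.traffic.smallestValue := by
  simp only [PETC.isTraceFrom_iff] at hne
  refine ⟨?_, fun s hs => ?_⟩
  · rintro ⟨e, h0, he⟩
    obtain ⟨l₀, hl₀⟩ := P.exists_sacWords_eq_rotation hiso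
    -- At index `l₀` the counter is `l₀ + 1`, past the threshold. This step must reject every basic
    -- invariant subspace of its SAC, yet one of them passes the test.
    have hstep := he l₀
    rw [P.eq_loop_of_infinite_execution h0 he, P.eq_loop_of_infinite_execution h0 he] at hstep
    cases hstep with
    | next l w hw hver =>
      obtain ⟨j, hj⟩ := hl₀ (l₀ + 1) (by omega) (by omega) w hw
      obtain ⟨V, hV, hV'⟩ := P.exists_verified_of_rotation hiso.ne_nil
        ((P.mem_sacWords_iff (by omega)).1 hw).1 hreg hne hj
      exact hver V hV hV'
  · rcases P.exists_eq_of_reachable hns hs with ⟨l, hl, rfl⟩ | h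
    · exact Or.inl (P.exists_step_loop hl)
    · exact Or.inr h
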